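/- **Setting.** A \emph{primitive recursive functional} $P(f_1,\dots,f_k;x_1,\dots,x_n)$ is given by a scheme built from $0$, the successor, the projections and the unary functions $f_1,\dots,f_k$ by composition and primitive recursion. The two-sorted language $\mathcal L$ has number variables, variables for unary functions, the symbols $0,s,<,=$ (for numbers), application $f(t)$, and a symbol for every such functional. A structure $(M,\mathcal X)$ consists of a first-order universe $M$, a set $\mathcal X$ of functions $M\to M$ over which the function variables range, and interpretations of the symbols. The theory $\mathsf{PRA}^2$ consists of the axioms for $0$, $s$ and $<$; the defining equations of all primitive recursive functionals; for each scheme $P$ the axiom $\forall \bar f\,\forall \bar y\,\exists g\,\forall x\; g(x)=P(\bar f;x,\bar y)$; and induction for quantifier-free formulas with number and function parameters. A theory $T$ \emph{implies} $T'$ \emph{over} $\mathsf{PRA}^2$ if every structure satisfying $\mathsf{PRA}^2+T$ satisfies $T'$. A set $X$ of functions $\omega\to\omega$ is \emph{PR-closed} if it is closed under primitive recursive functionals; the standard models of $\mathsf{PRA}^2$ are the structures $(\omega,X)$ with $X$ PR-closed. The formulas in $\Sigma^0_1$ (resp. $\Pi^0_1$) are those of the form $\exists\bar y\,\theta$ (resp.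 $\forall\bar y\,\theta$) with $\theta$ having only bounded number quantifiers; parameters of both sorts are allowed. $\Delta^0_1\text{-}\mathrm{CA}$ is the schema $$\forall n\,(\varphi(n)\leftrightarrow\psi(n))\to\exists f\,\forall n\,\big((\varphi(n)\to f(n)=1)\land(\neg\varphi(n)\to f(n)=0)\big)\qquad(\varphi\in\Sigma^0_1,\ \psi\in\Pi^0_1),$$ $\mathrm I\Sigma^0_1$ is induction for $\Sigma^0_1$ formulas, and $2^{\mathbb N}\text{-}\mathsf{RCA}_0$ is $\mathrm I\Sigma^0_1+\Delta^0_1\text{-}\mathrm{CA}$. For a finite string $\sigma$ let $B_\sigma$ be the set of functions extending $\sigma$. An \emph{instance} of the Baire Category Theorem is a sequence $(V_n)$ of dense open subsets of $\mathbb N^{\mathbb N}$, given by a function $v$ that lists (codes of) strings with $V_n=\bigcup_k B_{v(n,k)}$; density says that for all $n$ and every string $\sigma$ there are $k$ and a string $\tau$ extending both $\sigma$ and $v(n,k)$. A \emph{solution} is a function $h\in\bigcap_n V_n$. $\mathsf{BCT}$ is the sentence of $\mathcal L$ saying that every instance has a solution. **Theorem.** Over $\mathsf{PRA}^2$: 1.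 $\mathsf{BCT}$ does not imply $\Delta^0_1\text{-}\mathrm{CA}$, and it does not imply $2^{\mathbb N}\text{-}\mathsf{RCA}_0$. 2. $\Delta^0_1\text{-}\mathrm{CA}$ does not imply $\mathsf{BCT}$, and $2^{\mathbb N}\text{-}\mathsf{RCA}_0$ does not imply $\mathsf{BCT}$. This already holds for standard models, and in the following stronger form: 3. There is a primitive recursive instance of $\mathsf{BCT}$ (over $\omega$) no solution of which is bounded by a primitive recursive function. 4. There is a PR-closed set $X\subseteq\omega^\omega$, all of whose members are computable and bounded by primitive recursive functions, such that $(\omega,X)$ satisfies $\mathsf{PRA}^2$, full induction and $2^{\mathbb N}\text{-}\mathsf{RCA}_0$, but not $\mathsf{BCT}$. 5. There is a PR-closed set $X\subseteq\omega^\omega$ such that $(\omega,X)$ satisfies $\mathsf{PRA}^2$, full induction and $\mathsf{BCT}$, but not $\Delta^0_1\text{-}\mathrm{CA}$. Moreover, for every computable $g:\omega\to\{0,1\}$ that is not primitive recursive, $X$ can be chosen with $g\notin X$. -/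

import Mathlib

namespace RevMath

/-! ### Primitive recursive functionals of type 2 -/

/-- `Scheme a n` is the type of schemes that are primitive recursive relative to `a` unary
functions `f₀, …, f₍ₐ₋₁₎`, and that define a function of `n` number arguments: the `f_j` are
adjoined to the basic primitive recursive functions, and one closes under composition and
primitive recursion. (Bounded minimisation is then derivable.) -/
inductive Scheme (a : ℕ) : ℕ → Type
  | zero : Scheme a 0
  | succ : Scheme a 1
  | proj {n : ℕ} (i : Fin n) : Scheme a n
  | oracle (j : Fin a) : Scheme a 1
  | comp {n m : ℕ} (P : Scheme a m) (Q : Fin m → Scheme a n) : Scheme a n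
  | prec {n : ℕ} (P : Scheme a n) (Q : Scheme a (n + 2)) : Scheme a (n + 1)

/-- The standard meaning of a scheme: the value of the functional at `f₀, …` and `v`. In `prec`
the first number argument is the recursion variable. -/
def Scheme.eval {a : ℕ} (F : Fin a → ℕ → ℕ) : {n : ℕ} → Scheme a n → (Fin n → ℕ) → ℕ
  | _, .zero, _ => 0
  | _, .succ, v => v 0 + 1
  | _, .proj i, v => v i
  | _, .oracle j, v => F j (v 0)
  | _, .comp P Q, v => P.eval F (fun i => (Q i).eval F v)
  | _, .prec P Q, v =>
      Nat.rec (P.eval F (Fin.tail v))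
        (fun y r => Q.eval F (Fin.cons y (Fin.cons r (Fin.tail v)))) (v 0)

/-- A class of total functions is PR-closed if it is closed under all primitive recursive
functionals of functions in it. -/
def PRClosed (X : Set (ℕ → ℕ)) : Prop :=
  ∀ (a : ℕ) (P : Scheme a 1) (F : Fin a → ℕ → ℕ), (∀ j, F j ∈ X) →
    (fun x => P.eval F (fun _ => x)) ∈ X

/-! ### The two-sorted language -/

/-- Number terms in `k` free function variables and `n` free number variables. The symbols are
`0`, `s`, application of a function variable to a number, and a symbol for every primitive
recursive functional (in particular, with `a = 0`, for every primitive recursive function). -/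
inductive Term (k n : ℕ) : Type
  | var (i : Fin n) : Term k n
  | zero : Term k n
  | succ (t : Term k n) : Term k n
  | app (f : Fin k) (t : Term k n) : Term k n
  | fn {a m : ℕ} (P : Scheme a m) (F : Fin a → Fin k) (ts : Fin m → Term k n) : Term k n

/-- Formulas in `k` free function variables and `n` free number variables. Variables are de Bruijn
indices: a quantifier binds the variable with index `0` of its sort. `all`, `ex` quantify over
numbers, `allF`, `exF` over functions. -/
inductive Formula : ℕ → ℕ → Type
  | eq {k n : ℕ} (t u : Term k n) : Formula k n
  | lt {k n : ℕ} (t u : Term k n) : Formula k n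
  | neg {k n : ℕ} (φ : Formula k n) : Formula k n
  | and {k n : ℕ} (φ ψ : Formula k n) : Formula k n
  | or {k n : ℕ} (φ ψ : Formula k n) : Formula k n
  | imp {k n : ℕ} (φ ψ : Formula k n) : Formula k n
  | all {k n : ℕ} (φ : Formula k (n + 1)) : Formula k n
  | ex {k n : ℕ} (φ : Formula k (n + 1)) : Formula k n
  | allF {k n : ℕ} (φ : Formula (k + 1) n) : Formula k n
  | exF {k n : ℕ} (φ : Formula (k + 1) n) : Formula k n

/-- Simultaneous renaming of the function variables by `ρ` and substitution of `σ` for the number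
variables. -/
def Term.subst {k k' n n' : ℕ} (ρ : Fin k → Fin k') (σ : Fin n → Term k' n') :
    Term k n → Term k' n'
  | .var i => σ i
  | .zero => .zero
  | .succ t => .succ (t.subst ρ σ)
  | .app f t => .app (ρ f) (t.subst ρ σ)
  | .fn P F ts => .fn P (fun j => ρ (F j)) (fun i => (ts i).subst ρ σ)

/-- Weakening by one number variable. -/
def Term.lift {k n : ℕ} (t : Term k n) : Term k (n + 1) :=
  t.subst id (fun i => .var i.succ)

/-- Weakening by one function variable. -/
def Term.liftF {k n : ℕ} (t : Term k n) : Term (k + 1) n :=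
  t.subst Fin.succ .var

/-- Capture-avoiding substitution in formulas. -/
def Formula.subst : {k n : ℕ} → Formula k n → {k' n' : ℕ} → (Fin k → Fin k') →
    (Fin n → Term k' n') → Formula k' n'
  | _, _, .eq t u, _, _, ρ, σ => .eq (t.subst ρ σ) (u.subst ρ σ)
  | _, _, .lt t u, _, _, ρ, σ => .lt (t.subst ρ σ) (u.subst ρ σ)
  | _, _, .neg φ, _, _, ρ, σ => .neg (φ.subst ρ σ)
  | _, _, .and φ ψ, _, _, ρ, σ => .and (φ.subst ρ σ) (ψ.subst ρ σ)
  | _, _, .or φ ψ, _, _, ρ, σ => .or (φ.subst ρ σ) (ψ.subst ρ σ)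
  | _, _, .imp φ ψ, _, _, ρ, σ => .imp (φ.subst ρ σ) (ψ.subst ρ σ)
  | _, _, .all φ, _, _, ρ, σ => .all (φ.subst ρ (Fin.cons (.var 0) (fun i => (σ i).lift)))
  | _, _, .ex φ, _, _, ρ, σ => .ex (φ.subst ρ (Fin.cons (.var 0) (fun i => (σ i).lift)))
  | _, _, .allF φ, _, _, ρ, σ =>
      .allF (φ.subst (Fin.cons 0 (fun j => (ρ j).succ)) (fun i => (σ i).liftF))
  | _, _, .exF φ, _, _, ρ, σ =>
      .exF (φ.subst (Fin.cons 0 (fun j => (ρ j).succ)) (fun i => (σ i).liftF))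

/-- `φ(t, x₁, x₂, …)` for `φ(x₀, x₁, x₂, …)`. -/
def Formula.inst {k n : ℕ} (φ : Formula k (n + 1)) (t : Term k n) : Formula k n :=
  φ.subst id (Fin.cons t .var)

/-- `φ(s(x₀), x₁, x₂, …)` for `φ(x₀, x₁, x₂, …)`. -/
def Formula.next {k n : ℕ} (φ : Formula k (n + 1)) : Formula k (n + 1) :=
  φ.subst id (Fin.cons (.succ (.var 0)) (fun i => .var i.succ))

/-- Weakening of a formula by one function variable. -/
def Formula.liftF {k n : ℕ} (φ : Formula k n) : Formula (k + 1) n :=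
  φ.subst Fin.succ .var

/-- `φ ↔ ψ`. -/
def Formula.iff {k n : ℕ} (φ ψ : Formula k n) : Formula k n :=
  .and (.imp φ ψ) (.imp ψ φ)

/-! ### Structures, satisfaction, consequence -/

/-- A structure `(M, 𝒳)`: a first-order universe `M`, a collection `𝒳` of functions `M → M` over
which the function variables range, and interpretations of `0`, `s`, `<` and the functional
symbols. Equality is interpreted as equality. -/
structure Model where
  M : Type
  X : Set (M → M)
  zero : M
  succ : M → M
  lt : M → M → Prop
  fn : {a m : ℕ} → Scheme a m → (Fin a → X) → (Fin m → M) → M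

/-- Value of a term. -/
def Term.value (S : Model) {k n : ℕ} (F : Fin k → S.X) (v : Fin n → S.M) : Term k n → S.M
  | .var i => v i
  | .zero => S.zero
  | .succ t => S.succ (t.value S F v)
  | .app f t => (F f).1 (t.value S F v)
  | .fn P G ts => S.fn P (fun j => F (G j)) (fun i => (ts i).value S F v)

/-- Truth of a formula under an assignment. -/
def Formula.Holds (S : Model) : {k n : ℕ} → Formula k n → (Fin k → S.X) → (Fin n → S.M) → Prop
  | _, _, .eq t u, F, v => t.value S F v = u.value S F v
  | _, _, .lt t u, F, v => S.lt (t.value S F v) (u.value S F v)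
  | _, _, .neg φ, F, v => ¬ φ.Holds S F v
  | _, _, .and φ ψ, F, v => φ.Holds S F v ∧ ψ.Holds S F v
  | _, _, .or φ ψ, F, v => φ.Holds S F v ∨ ψ.Holds S F v
  | _, _, .imp φ ψ, F, v => φ.Holds S F v → ψ.Holds S F v
  | _, _, .all φ, F, v => ∀ x : S.M, φ.Holds S F (Fin.cons x v)
  | _, _, .ex φ, F, v => ∃ x : S.M, φ.Holds S F (Fin.cons x v)
  | _, _, .allF φ, F, v => ∀ f : S.X, φ.Holds S (Fin.cons f F) v
  | _, _, .exF φ, F, v => ∃ f : S.X, φ.Holds S (Fin.cons f F) v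

/-- A formula together with its numbers of free variables of both sorts. -/
abbrev AnyFormula : Type := Σ k n : ℕ, Formula k n

/-- A theory. An open formula in a theory stands for its universal closure. -/
abbrev Theory : Type := Set AnyFormula

/-- `S` satisfies the universal closure of `φ`. -/
def Model.Sat (S : Model) (φ : AnyFormula) : Prop :=
  ∀ (F : Fin φ.1 → S.X) (v : Fin φ.2.1 → S.M), φ.2.2.Holds S F v

/-- `S` is a model of the theory `T`. -/
def Model.Models (S : Model) (T : Theory) : Prop := ∀ φ ∈ T, S.Sat φ

/-- `T` implies `T'`: every model of `T` is a model of `T'`. -/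
def Implies (T T' : Theory) : Prop := ∀ S : Model, S.Models T → S.Models T'

/-- The standard structure `(ω, X)`. -/
abbrev standard (X : Set (ℕ → ℕ)) : Model where
  M := ℕ
  X := X
  zero := 0
  succ := Nat.succ
  lt := fun x y => x < y
  fn := fun P F v => P.eval (fun j => (F j).1) v

/-! ### Classes of formulas -/

/-- Quantifier-free formulas. -/
inductive IsQF : {k n : ℕ} → Formula k n → Prop
  | eq {k n : ℕ} (t u : Term k n) : IsQF (.eq t u)
  | lt {k n : ℕ} (t u : Term k n) : IsQF (.lt t u)
  | neg {k n : ℕ} {φ : Formula k n} : IsQF φ → IsQF (.neg φ)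
  | and {k n : ℕ} {φ ψ : Formula k n} : IsQF φ → IsQF ψ → IsQF (.and φ ψ)
  | or {k n : ℕ} {φ ψ : Formula k n} : IsQF φ → IsQF ψ → IsQF (.or φ ψ)
  | imp {k n : ℕ} {φ ψ : Formula k n} : IsQF φ → IsQF ψ → IsQF (.imp φ ψ)

/-- `Δ⁰₀` formulas: all quantifiers are bounded number quantifiers `∀ x < t` or `∃ x < t`, where
`x` does not occur in `t`. -/
inductive IsDelta0 : {k n : ℕ} → Formula k n → Prop
  | eq {k n : ℕ} (t u : Term k n) : IsDelta0 (.eq t u)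
  | lt {k n : ℕ} (t u : Term k n) : IsDelta0 (.lt t u)
  | neg {k n : ℕ} {φ : Formula k n} : IsDelta0 φ → IsDelta0 (.neg φ)
  | and {k n : ℕ} {φ ψ : Formula k n} : IsDelta0 φ → IsDelta0 ψ → IsDelta0 (.and φ ψ)
  | or {k n : ℕ} {φ ψ : Formula k n} : IsDelta0 φ → IsDelta0 ψ → IsDelta0 (.or φ ψ)
  | imp {k n : ℕ} {φ ψ : Formula k n} : IsDelta0 φ → IsDelta0 ψ → IsDelta0 (.imp φ ψ)
  | ball {k n : ℕ} (t : Term k n) {φ : Formula k (n + 1)} : IsDelta0 φ →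
      IsDelta0 (.all (.imp (.lt (.var 0) t.lift) φ))
  | bex {k n : ℕ} (t : Term k n) {φ : Formula k (n + 1)} : IsDelta0 φ →
      IsDelta0 (.ex (.and (.lt (.var 0) t.lift) φ))

/-- `Σ⁰₁` formulas: `∃ y₁ … ∃ yᵣ θ` with `θ` in `Δ⁰₀`. -/
inductive IsSigma1 : {k n : ℕ} → Formula k n → Prop
  | of {k n : ℕ} {φ : Formula k n} : IsDelta0 φ → IsSigma1 φ
  | ex {k n : ℕ} {φ : Formula k (n + 1)} : IsSigma1 φ → IsSigma1 (.ex φ)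

/-- `Π⁰₁` formulas: `∀ y₁ … ∀ yᵣ θ` with `θ` in `Δ⁰₀`. -/
inductive IsPi1 : {k n : ℕ} → Formula k n → Prop
  | of {k n : ℕ} {φ : Formula k n} : IsDelta0 φ → IsPi1 φ
  | all {k n : ℕ} {φ : Formula k (n + 1)} : IsPi1 φ → IsPi1 (.all φ)

/-! ### The theories -/

/-- The induction axiom `(φ(0) ∧ ∀ x (φ(x) → φ(s x))) → ∀ x φ(x)`. -/
def indAxiom {k n : ℕ} (φ : Formula k (n + 1)) : Formula k n :=
  .imp (.and (φ.inst .zero) (.all (.imp φ φ.next))) (.all φ)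

/-- The axioms of `PRA²`. -/
inductive PRA2Axiom : {k n : ℕ} → Formula k n → Prop
  /-- `0 ≠ s(x)` -/
  | zero_ne_succ : PRA2Axiom (k := 0) (n := 1) (.neg (.eq .zero (.succ (.var 0))))
  /-- `s(x) = s(y) → x = y` -/
  | succ_inj : PRA2Axiom (k := 0) (n := 2)
      (.imp (.eq (.succ (.var 0)) (.succ (.var 1))) (.eq (.var 0) (.var 1)))
  /-- `¬ x < 0` -/
  | not_lt_zero : PRA2Axiom (k := 0) (n := 1) (.neg (.lt (.var 0) .zero))
  /-- `x < s(y) ↔ (x < y ∨ x = y)` -/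
  | lt_succ : PRA2Axiom (k := 0) (n := 2)
      (.iff (.lt (.var 0) (.succ (.var 1)))
        (.or (.lt (.var 0) (.var 1)) (.eq (.var 0) (.var 1))))
  /-- defining equations of the functional symbols -/
  | def_zero (a : ℕ) : PRA2Axiom (k := a) (n := 0)
      (.eq (.fn (.zero : Scheme a 0) id Fin.elim0) .zero)
  | def_succ (a : ℕ) : PRA2Axiom (k := a) (n := 1)
      (.eq (.fn (.succ : Scheme a 1) id .var) (.succ (.var 0)))
  | def_proj (a : ℕ) {n : ℕ} (i : Fin n) : PRA2Axiom (k := a) (n := n)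
      (.eq (.fn (.proj i : Scheme a n) id .var) (.var i))
  | def_oracle {a : ℕ} (j : Fin a) : PRA2Axiom (k := a) (n := 1)
      (.eq (.fn (.oracle j) id .var) (.app j (.var 0)))
  | def_comp {a n m : ℕ} (P : Scheme a m) (Q : Fin m → Scheme a n) : PRA2Axiom (k := a) (n := n)
      (.eq (.fn (.comp P Q) id .var) (.fn P id (fun i => .fn (Q i) id .var)))
  | def_prec_zero {a n : ℕ} (P : Scheme a n) (Q : Scheme a (n + 2)) : PRA2Axiom (k := a) (n := n)
      (.eq (.fn (.prec P Q) id (Fin.cons .zero .var)) (.fn P id .var))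
  | def_prec_succ {a n : ℕ} (P : Scheme a n) (Q : Scheme a (n + 2)) :
      PRA2Axiom (k := a) (n := n + 1)
        (.eq (.fn (.prec P Q) id (Fin.cons (.succ (.var 0)) (fun i => .var i.succ)))
          (.fn Q id (Fin.cons (.var 0) (Fin.cons (.fn (.prec P Q) id .var)
            (fun i => .var i.succ)))))
  /-- for all `f₀, …` and numbers `y₀, …` there is a `g` with `g(x) = P(f₀, …; x, y₀, …)` for
  all `x` -/
  | exists_fun {a m : ℕ} (P : Scheme a (m + 1)) : PRA2Axiom (k := a) (n := m)
      (.exF (.all (.eq (.app 0 (.var 0)) (.fn P Fin.succ .var))))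
  /-- induction for quantifier-free formulas, with number and function parameters -/
  | ind {k n : ℕ} (θ : Formula k (n + 1)) : IsQF θ → PRA2Axiom (indAxiom θ)

/-- The theory `PRA²`. -/
def PRA2 : Theory := {φ | PRA2Axiom φ.2.2}

/-- `IΣ⁰₁`: induction for `Σ⁰₁` formulas with parameters. -/
def ISigma01 : Theory :=
  {χ | ∃ (k n : ℕ) (φ : Formula k (n + 1)), IsSigma1 φ ∧ χ = ⟨k, n, indAxiom φ⟩}

/-- Full induction: induction for all formulas of the language, with parameters. -/
def FullInduction : Theory :=
  {χ | ∃ (k n : ℕ) (φ : Formula k (n + 1)), χ = ⟨k, n, indAxiom φ⟩}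

/-- The comprehension axiom
`∀ x (φ(x) ↔ ψ(x)) → ∃ f ∀ x ((φ(x) → f(x) = 1) ∧ (¬ φ(x) → f(x) = 0))`. -/
def compAxiom {k n : ℕ} (φ ψ : Formula k (n + 1)) : Formula k n :=
  .imp (.all (.iff φ ψ))
    (.exF (.all (.and
      (.imp φ.liftF (.eq (.app 0 (.var 0)) (.succ .zero)))
      (.imp (.neg φ.liftF) (.eq (.app 0 (.var 0)) .zero)))))

/-- `Δ⁰₁-CA`: `Δ⁰₁` comprehension, with parameters. -/
def Delta01CA : Theory :=
  {χ | ∃ (k n : ℕ) (φ ψ : Formula k (n + 1)), IsSigma1 φ ∧ IsPi1 ψ ∧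
    χ = ⟨k, n, compAxiom φ ψ⟩}

/-- `2^ℕ-RCA₀`, the conjunction of `IΣ⁰₁` and `Δ⁰₁-CA`. -/
def TwoNRCA0 : Theory := ISigma01 ∪ Delta01CA

/-! ### Primitive recursive coding of pairs and finite strings -/

namespace Scheme

/-- constant `0` -/
def zeroN (n : ℕ) : Scheme 0 n := .comp .zero Fin.elim0

/-- `s ∘ P` -/
def succOf {n : ℕ} (P : Scheme 0 n) : Scheme 0 n := .comp .succ ![P]

/-- `x ↦ x ∸ 1` -/
def pred : Scheme 0 1 := .prec .zero (.proj 0)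

/-- `(x, y) ↦ x + y` -/
def add : Scheme 0 2 := .prec (.proj 0) (succOf (.proj 1))

/-- `(x, y) ↦ x * y` -/
def mul : Scheme 0 2 := .prec (zeroN 1) (.comp add ![.proj 1, .proj 2])

/-- `(x, y) ↦ y ∸ x` -/
def rsub : Scheme 0 2 := .prec (.proj 0) (.comp pred ![.proj 1])

/-- `(x, y, a, b) ↦ a` if `x < y`, and `b` otherwise -/
def ifLt : Scheme 0 4 :=
  .comp (.prec (.proj 1) (.proj 2) : Scheme 0 3)
    ![.comp rsub ![.proj 0, .proj 1], .proj 2, .proj 3]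

/-- `(x, y) ↦ ⟨x, y⟩`, where `⟨x, y⟩ = y² + x` if `x < y`, and `x² + x + y` otherwise -/
def pair : Scheme 0 2 :=
  .comp ifLt ![.proj 0, .proj 1,
    .comp add ![.comp mul ![.proj 1, .proj 1], .proj 0],
    .comp add ![.comp add ![.comp mul ![.proj 0, .proj 0], .proj 0], .proj 1]]

/-- integer square root -/
def sqrt : Scheme 0 1 :=
  .prec .zero (.comp ifLt
    ![succOf (.proj 0), .comp mul ![succOf (.proj 1), succOf (.proj 1)],
      .proj 1, succOf (.proj 1)])

/-- `x ↦ x ∸ (√x)²` -/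
def sqrtRem : Scheme 0 1 := .comp rsub ![.comp mul ![sqrt, sqrt], .proj 0]

/-- first component of a pair -/
def left : Scheme 0 1 := .comp ifLt ![sqrtRem, sqrt, sqrtRem, sqrt]

/-- second component of a pair -/
def right : Scheme 0 1 := .comp ifLt ![sqrtRem, sqrt, sqrt, .comp rsub ![sqrt, sqrtRem]]

/-- `(i, σ) ↦` the string `σ` without its first `i` entries (empty if `σ` has at most `i`
entries). Every number codes exactly one finite string: `0` codes the empty string, and
`⟨x, τ⟩ + 1` codes the string with first entry `x` followed by the string coded by `τ`. -/
def drop : Scheme 0 2 := .prec (.proj 0) (.comp right ![.comp pred ![.proj 1]])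

/-- `(i, σ) ↦` the entry of the string `σ` with index `i` (for `i` less than the length) -/
def entry : Scheme 0 2 := .comp left ![.comp pred ![drop]]

end Scheme

/-- The term `⟨t, u⟩`. -/
def pairT {k n : ℕ} (t u : Term k n) : Term k n := .fn Scheme.pair Fin.elim0 ![t, u]

/-- The term for the entry of the string `s` with index `i`. -/
def entryT {k n : ℕ} (i s : Term k n) : Term k n := .fn Scheme.entry Fin.elim0 ![i, s]

/-- The formula `i < length(s)` for a string `s`: dropping `i` entries leaves a non-empty string. -/
def ltLength {k n : ℕ} (i s : Term k n) : Formula k n :=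
  .neg (.eq (.fn Scheme.drop Fin.elim0 ![i, s]) .zero)

/-- The formula saying that the string `t` extends the string `s`. -/
def extends_ {k n : ℕ} (s t : Term k n) : Formula k n :=
  .all (.imp (ltLength (.var 0) s.lift)
    (.and (ltLength (.var 0) t.lift)
      (.eq (entryT (.var 0) t.lift) (entryT (.var 0) s.lift))))

/-- The formula saying that the function `h` lies in the basic open set `B_s` of all functions that
extend the string `s`. -/
def inBasic {k n : ℕ} (s : Term k n) (h : Fin k) : Formula k n :=
  .all (.imp (ltLength (.var 0) s.lift) (.eq (.app h (.var 0)) (entryT (.var 0) s.lift)))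

/-- The Baire Category Theorem for `ℕ^ℕ`: for every `v`, if every open set
`V_n = ⋃_k B_{v(⟨n, k⟩)}` is dense, that is, for all `n` and every string `σ` there are `k` and a
string `τ` that extends both `σ` and `v(⟨n, k⟩)`, then there is an `h` such that for all `n` there
is a `k` with `h ∈ B_{v(⟨n, k⟩)}`. -/
def BCTSentence : Formula 0 0 :=
  .allF (.imp
    (.all (.all (.ex (.ex (.and
      (extends_ (.var 2) (.var 0))
      (extends_ (.app 0 (pairT (.var 3) (.var 1))) (.var 0)))))))
    (.exF (.all (.ex (inBasic (.app 1 (pairT (.var 1) (.var 0))) 0)))))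

/-- The Baire Category Theorem as a theory with one axiom. -/
def BCT : Theory := {⟨0, 0, BCTSentence⟩}

/-! ### Instances over the standard natural numbers -/

/-- `V` lists, for each `n`, the strings `V n 0, V n 1, …` of a dense open set
`⋃_k B_{V n k}` in `ω^ω`. -/
def IsInstance (V : ℕ → ℕ → List ℕ) : Prop :=
  ∀ (n : ℕ) (σ : List ℕ), ∃ (k : ℕ) (τ : List ℕ), σ <+: τ ∧ V n k <+: τ

/-- `h ∈ ⋂_n ⋃_k B_{V n k}`. -/
def IsSolution (V : ℕ → ℕ → List ℕ) (h : ℕ → ℕ) : Prop :=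
  ∀ n, ∃ k, ∀ (i : ℕ) (hi : i < (V n k).length), h i = (V n k)[i]

/-- `h` is bounded by a primitive recursive function. -/
def PRBounded (h : ℕ → ℕ) : Prop :=
  ∃ b : ℕ → ℕ, Primrec b ∧ ∀ x, h x ≤ b x

end RevMath

namespace RevMath

/-! ### Evaluation of schemes -/

namespace Scheme

variable {a b n m : ℕ}

/-! Both separations use standard models. There induction for all formulas is automatic, and
PR-closure of `X` yields `PRA²`, so only comprehension and `BCT` have to be decided.

For the failure of `BCT`, let `X` consist of the computable functions with a primitive recursive
bound. It is PR-closed because such bounds survive composition and recursion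
(`Scheme.exists_bound`). A `Δ⁰₁` set with parameters in `X` has a computable characteristic
function, bounded by `1`, so `Δ⁰₁-CA` holds (`standard_models_delta01CA`). In
`exists_primrec_instance` each function `ack m` gives rise to dense open sets which force a solution
to exceed `ack m` at some argument. Only time-bounded computations of `ack` are inspected, so the
instance is primitive recursive, while a solution escapes every primitive recursive bound.

For the failure of `Δ⁰₁-CA`, the classical Baire theorem for sequences `F` of functions provides a
generic `F`, and `X` consists of the functions primitive recursive in finitely many `F j`. An
instance computed from `F 0, …, F (a - 1)` is solved by `F a` (`mem_closure_solvesAt`,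
`exists_generic`). A given `g` that is not primitive recursive stays outside `X`, because it can be
avoided on a dense open set for each of the countably many schemes (`dense_app_ne`). If `g` is
computable with values `0` and `1`, it is `Δ⁰₁`-definable by time-bounded evaluation, so
comprehension fails (`not_standard_models_delta01CA`). Such a `g` comes from diagonalising over the
primitive recursive functions. -/

theorem eval_congr (F : Fin a → ℕ → ℕ) (P : Scheme a n) {v w : Fin n → ℕ} (h : ∀ i, v i = w i) :
    P.eval F v = P.eval F w := by rw [funext h]

theorem eval_comp (F : Fin a → ℕ → ℕ) (P : Scheme a m) (Q : Fin m → Scheme a n) (v : Fin n → ℕ) :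
    (comp P Q).eval F v = P.eval F (fun i => (Q i).eval F v) := rfl

/-- The standard way to evaluate a recursion below: guess the closed form `φ` and check its two
recursion equations. -/
theorem eval_recursion (F : Fin a → ℕ → ℕ) (P : Scheme a n) (Q : Scheme a (n + 2))
    (v : Fin (n + 1) → ℕ) (φ : ℕ → ℕ) (h0 : P.eval F (Fin.tail v) = φ 0)
    (hs : ∀ y, Q.eval F (Fin.cons y (Fin.cons (φ y) (Fin.tail v))) = φ (y + 1)) :
    (prec P Q).eval F v = φ (v 0) := by
  have H : ∀ x, (Nat.rec (P.eval F (Fin.tail v))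
      (fun y r => Q.eval F (Fin.cons y (Fin.cons r (Fin.tail v)))) x : ℕ) = φ x := fun x => by
    induction x with
    | zero => exact h0
    | succ y ih => exact (congrArg (fun r => Q.eval F (Fin.cons y (Fin.cons r (Fin.tail v)))) ih).trans (hs y)
  exact H (v 0)

theorem cons_cons_two (x y : ℕ) (v : Fin (n + 1) → ℕ) :
    (Fin.cons x (Fin.cons y v : Fin (n + 2) → ℕ) : Fin (n + 3) → ℕ) 2 = v 0 := rfl

/-- Substitution of the functions defined by the schemes `S j` for the oracles. -/
def substOracle (S : Fin a → Scheme b 1) : {n : ℕ} → Scheme a n → Scheme b n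
  | _, .zero => .zero
  | _, .succ => .succ
  | _, .proj i => .proj i
  | _, .oracle j => S j
  | _, .comp P Q => .comp (P.substOracle S) (fun i => (Q i).substOracle S)
  | _, .prec P Q => .prec (P.substOracle S) (Q.substOracle S)

theorem eval_substOracle (S : Fin a → Scheme b 1) (F : Fin b → ℕ → ℕ) (P : Scheme a n)
    (v : Fin n → ℕ) :
    (P.substOracle S).eval F v = P.eval (fun j x => (S j).eval F (fun _ => x)) v := by
  induction P with
  | zero => rfl
  | succ => rfl
  | proj i => rfl
  | oracle j => exact eval_congr _ _ fun i => by rw [Subsingleton.elim i 0]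
  | comp P Q ihP ihQ => simp only [substOracle, eval, ihP, ihQ]
  | prec P Q ihP ihQ => simp only [substOracle, eval, ihP, ihQ]

@[simp] theorem eval_zeroN (F : Fin 0 → ℕ → ℕ) (v : Fin n → ℕ) : (zeroN n).eval F v = 0 := rfl

@[simp] theorem eval_succOf (F : Fin 0 → ℕ → ℕ) (P : Scheme 0 n) (v : Fin n → ℕ) :
    (succOf P).eval F v = P.eval F v + 1 := rfl

@[simp] theorem eval_pred (F : Fin 0 → ℕ → ℕ) (v : Fin 1 → ℕ) : pred.eval F v = v 0 - 1 :=
  eval_recursion F _ _ v (fun x => x - 1) rfl fun _ => rfl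

@[simp] theorem eval_add (F : Fin 0 → ℕ → ℕ) (v : Fin 2 → ℕ) : add.eval F v = v 0 + v 1 := by
  refine eval_recursion F _ _ v (fun x => x + v 1) ?_ fun y => ?_
  · simp [eval, Fin.tail]
  · simp [eval]; omega

@[simp] theorem eval_mul (F : Fin 0 → ℕ → ℕ) (v : Fin 2 → ℕ) : mul.eval F v = v 0 * v 1 := by
  refine eval_recursion F _ _ v (fun x => x * v 1) ?_ fun y => ?_
  · simp
  · simp [eval, cons_cons_two, Fin.tail, Nat.succ_mul]

@[simp] theorem eval_rsub (F : Fin 0 → ℕ → ℕ) (v : Fin 2 → ℕ) : rsub.eval F v = v 1 - v 0 := by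
  refine eval_recursion F _ _ v (fun x => v 1 - x) ?_ fun y => ?_
  · simp [eval, Fin.tail]
  · simp [eval]; omega

@[simp] theorem eval_ifLt (F : Fin 0 → ℕ → ℕ) (v : Fin 4 → ℕ) :
    ifLt.eval F v = if v 0 < v 1 then v 2 else v 3 := by
  -- The recursion variable is `v 1 - v 0`, which vanishes exactly in the `else` case; the recursion
  -- step discards the previous value.
  rw [ifLt, eval_comp, eval_recursion F _ _ _ (fun x => if x = 0 then v 3 else v 2)]
  · simp only [Matrix.cons_val_zero, Matrix.cons_val_one, eval_comp, eval_rsub, eval,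
      Nat.sub_eq_zero_iff_le]
    split_ifs <;> first | rfl | omega
  · rfl
  · exact fun _ => rfl

@[simp] theorem eval_pair (F : Fin 0 → ℕ → ℕ) (v : Fin 2 → ℕ) :
    pair.eval F v = Nat.pair (v 0) (v 1) := by
  simp [pair, eval_comp, eval, Nat.pair]

@[simp] theorem eval_sqrt (F : Fin 0 → ℕ → ℕ) (v : Fin 1 → ℕ) :
    sqrt.eval F v = Nat.sqrt (v 0) := by
  refine eval_recursion F _ _ v Nat.sqrt (by simp [eval]) fun y => ?_
  simp only [eval_comp, eval_ifLt, Matrix.cons_val_zero, Matrix.cons_val_one, Matrix.cons_val,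
    eval_succOf, eval_mul, eval, Fin.cons_zero, Fin.cons_one]
  have h1 := Nat.sqrt_le y
  have h3 := Nat.lt_succ_sqrt y
  simp only [Nat.succ_eq_add_one] at h3
  split_ifs with h
  · exact Nat.eq_sqrt.2 ⟨by omega, by omega⟩
  · refine Nat.eq_sqrt.2 ⟨by omega, ?_⟩
    nlinarith

@[simp] theorem eval_sqrtRem (F : Fin 0 → ℕ → ℕ) (v : Fin 1 → ℕ) :
    sqrtRem.eval F v = v 0 - Nat.sqrt (v 0) * Nat.sqrt (v 0) := by
  simp [sqrtRem, eval_comp, eval]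

@[simp] theorem eval_left (F : Fin 0 → ℕ → ℕ) (v : Fin 1 → ℕ) :
    left.eval F v = (Nat.unpair (v 0)).1 := by
  simp only [left, eval_comp, eval_ifLt, Nat.unpair]
  simp only [Matrix.cons_val_zero, Matrix.cons_val_one, Matrix.cons_val, eval_sqrtRem, eval_sqrt]
  split_ifs <;> rfl

@[simp] theorem eval_right (F : Fin 0 → ℕ → ℕ) (v : Fin 1 → ℕ) :
    right.eval F v = (Nat.unpair (v 0)).2 := by
  simp only [right, eval_comp, eval_ifLt, Nat.unpair]
  simp only [Matrix.cons_val_zero, Matrix.cons_val_one, Matrix.cons_val, eval_sqrtRem, eval_sqrt,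
    eval_comp, eval_rsub]
  split_ifs <;> rfl

/-- The coding of strings in the language is the `Encodable` coding of lists: removing the head
means taking the predecessor and then the second component, and this fixes the code `0` of the empty
string. -/
theorem eval_drop (F : Fin 0 → ℕ → ℕ) (v : Fin 2 → ℕ) (l : List ℕ) (hl : v 1 = Encodable.encode l) :
    drop.eval F v = Encodable.encode (l.drop (v 0)) := by
  refine eval_recursion F _ _ v (fun x => Encodable.encode (l.drop x)) ?_ fun y => ?_
  · simp [eval, Fin.tail, hl]
  · simp only [← List.drop_drop, eval_comp, eval_right]
    cases List.drop y l <;> simp [eval_comp, eval]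

theorem eval_entry (F : Fin 0 → ℕ → ℕ) (v : Fin 2 → ℕ) (l : List ℕ) (hl : v 1 = Encodable.encode l)
    (h : v 0 < l.length) : entry.eval F v = l[v 0] := by
  simp only [entry, eval_comp, eval_left, Matrix.cons_val_fin_one, eval_pred]
  rw [eval_drop F v l hl, List.drop_eq_getElem_cons h, Encodable.encode_list_cons]
  simp

/-! ### Derived schemes with oracles -/

/-- A scheme without oracles, as a scheme with oracles. -/
def lift (P : Scheme 0 n) : Scheme a n := P.substOracle Fin.elim0

@[simp] theorem eval_lift (F : Fin a → ℕ → ℕ) (P : Scheme 0 n) (v : Fin n → ℕ) :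
    (P.lift : Scheme a n).eval F v = P.eval Fin.elim0 v := by
  rw [lift, eval_substOracle]
  congr
  exact Subsingleton.elim _ _

/-- `B(P, Q)` -/
def op (B : Scheme 0 2) (P Q : Scheme a n) : Scheme a n := .comp B.lift ![P, Q]

@[simp] theorem eval_op (F : Fin a → ℕ → ℕ) (B : Scheme 0 2) (P Q : Scheme a n) (v : Fin n → ℕ) :
    (op B P Q).eval F v = B.eval Fin.elim0 ![P.eval F v, Q.eval F v] := by
  rw [op, eval_comp, eval_lift]
  exact eval_congr _ _ fun i => by fin_cases i <;> rfl

/-- constant `c` -/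
def const (c : ℕ) : Scheme a n := Nat.rec (.comp .zero Fin.elim0) (fun _ P => .comp .succ ![P]) c

@[simp] theorem eval_const (F : Fin a → ℕ → ℕ) (c : ℕ) (v : Fin n → ℕ) :
    (const c : Scheme a n).eval F v = c := by
  induction c with
  | zero => rfl
  | succ c ih => exact congrArg Nat.succ ih

/-- Insertion of a variable that the scheme does not depend on, behind the first one. -/
def skip (P : Scheme a (n + 1)) : Scheme a (n + 2) :=
  .comp P (Fin.cons (.proj 0) fun i => .proj i.succ.succ)

@[simp] theorem eval_skip (F : Fin a → ℕ → ℕ) (P : Scheme a (n + 1)) (x y : ℕ) (v : Fin n → ℕ) :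
    P.skip.eval F (Fin.cons x (Fin.cons y v) : Fin (n + 2) → ℕ) = P.eval F (Fin.cons x v) := by
  rw [skip, eval_comp]
  refine eval_congr _ _ fun i => ?_
  cases i using Fin.cases <;> rfl

/-- `(t, v) ↦ ∑ x < t, P (x, v)` -/
def sumLt (P : Scheme a (n + 1)) : Scheme a (n + 1) :=
  .prec (const 0) (op add (.proj 1) P.skip)

theorem eval_sumLt (F : Fin a → ℕ → ℕ) (P : Scheme a (n + 1)) (t : ℕ) (v : Fin n → ℕ) :
    P.sumLt.eval F (Fin.cons t v : Fin (n + 1) → ℕ) =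
      ∑ x ∈ Finset.range t, P.eval F (Fin.cons x v) := by
  refine eval_recursion F _ _ _ (fun t => ∑ x ∈ Finset.range t, P.eval F (Fin.cons x v)) ?_
    fun y => ?_
  · simp
  · simp [Finset.sum_range_succ, eval]

/-- `(t, v) ↦ ∏ x < t, P (x, v)` -/
def prodLt (P : Scheme a (n + 1)) : Scheme a (n + 1) :=
  .prec (const 1) (op mul (.proj 1) P.skip)

theorem eval_prodLt (F : Fin a → ℕ → ℕ) (P : Scheme a (n + 1)) (t : ℕ) (v : Fin n → ℕ) :
    P.prodLt.eval F (Fin.cons t v : Fin (n + 1) → ℕ) =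
      ∏ x ∈ Finset.range t, P.eval F (Fin.cons x v) := by
  refine eval_recursion F _ _ _ (fun t => ∏ x ∈ Finset.range t, P.eval F (Fin.cons x v)) ?_
    fun y => ?_
  · simp
  · simp [Finset.prod_range_succ, eval]

/-- `P(t(v), v)` -/
def atFirst (P : Scheme a (n + 1)) (t : Scheme a n) : Scheme a n := .comp P (Fin.cons t .proj)

@[simp] theorem eval_atFirst (F : Fin a → ℕ → ℕ) (P : Scheme a (n + 1)) (t : Scheme a n)
    (v : Fin n → ℕ) : (P.atFirst t).eval F v = P.eval F (Fin.cons (t.eval F v) v) := by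
  rw [atFirst, eval_comp]
  refine eval_congr _ _ fun i => ?_
  cases i using Fin.cases <;> rfl

end Scheme

/-- Every primitive recursive function is given by a scheme without oracles. -/
theorem exists_scheme_of_nat_primrec {f : ℕ → ℕ} (hf : Nat.Primrec f) :
    ∃ P : Scheme 0 1, ∀ F v, P.eval F v = f (v 0) := by
  induction hf with
  | zero => exact ⟨.const 0, fun F v => by simp⟩
  | succ => exact ⟨.succ, fun F v => rfl⟩
  | left => exact ⟨.left, fun F v => by simp⟩
  | right => exact ⟨.right, fun F v => by simp⟩
  | pair _ _ ihf ihg =>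
    obtain ⟨P, hP⟩ := ihf
    obtain ⟨Q, hQ⟩ := ihg
    exact ⟨.op .pair P Q, fun F v => by simp [hP, hQ]⟩
  | comp _ _ ihf ihg =>
    obtain ⟨P, hP⟩ := ihf
    obtain ⟨Q, hQ⟩ := ihg
    exact ⟨.comp P ![Q], fun F v => by simp [hP, hQ, Scheme.eval_comp]⟩
  | @prec f g _ _ ihf ihg =>
    obtain ⟨P, hP⟩ := ihf
    obtain ⟨Q, hQ⟩ := ihg
    -- `Nat.Primrec.prec` puts the parameter before the recursion variable and packs its arguments
    -- into pairs; schemes recurse on the first argument. The projections permute the arguments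
    -- accordingly.
    refine ⟨.comp (.prec P (.comp Q ![.op .pair (.proj 2) (.op .pair (.proj 0) (.proj 1))]))
      ![.right, .left], fun F v => ?_⟩
    rw [Scheme.eval_comp, Scheme.eval_recursion F _ _ _ (fun n => Nat.rec (f (v 0).unpair.1)
      (fun y IH => g (Nat.pair (v 0).unpair.1 (Nat.pair y IH))) n)]
    · simp only [Matrix.cons_val_zero, Scheme.eval_right, Nat.unpaired]
    · simp [hP, Fin.tail]
    · intro y
      simp [hQ, Scheme.eval, Scheme.cons_cons_two, Fin.tail]

theorem exists_scheme_of_primrec {f : ℕ → ℕ} (hf : Primrec f) :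
    ∃ P : Scheme 0 1, ∀ F v, P.eval F v = f (v 0) :=
  exists_scheme_of_nat_primrec (Primrec.nat_iff.1 hf)


/-! ### Functionals of computable, primitive recursive, bounded and continuous functions -/

namespace Scheme

variable {a n : ℕ} {α : Type*}

/-- The domain `α` is arbitrary because in a recursion the induction hypothesis for the step is
needed over `α × ℕ × ℕ`. -/
theorem computable_eval {F : Fin a → ℕ → ℕ} (hF : ∀ j, Computable (F j)) [Primcodable α]
    (P : Scheme a n) {v : Fin n → α → ℕ} (hv : ∀ i, Computable (v i)) :
    Computable fun x => P.eval F (fun i => v i x) := by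
  induction P generalizing α with
  | zero => exact Computable.const 0
  | succ => exact Computable.succ.comp (hv 0)
  | proj i => exact hv i
  | oracle j => exact (hF j).comp (hv 0)
  | comp P Q ihP ihQ => exact ihP fun i => ihQ i hv
  | prec P Q ihP ihQ =>
    refine Computable.nat_rec (f := v 0) (g := fun x => P.eval F (fun i => v i.succ x))
      (h := fun x p => Q.eval F (Fin.cons p.1 (Fin.cons p.2 fun i => v i.succ x)))
      (hv 0) (ihP fun i => hv i.succ) ?_
    have := ihQ (α := α × ℕ × ℕ) (v := Fin.cons (fun p => p.2.1) (Fin.cons (fun p => p.2.2)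
      fun i p => v i.succ p.1)) ?_
    · refine this.of_eq fun p => eval_congr _ _ fun i => ?_
      refine Fin.cases rfl (fun i => Fin.cases rfl (fun i => rfl) i) i
    · refine fun i => Fin.cases ?_ (fun i => Fin.cases ?_ (fun i => ?_) i) i
      · exact Computable.fst.comp Computable.snd
      · exact Computable.snd.comp Computable.snd
      · exact (hv i.succ).comp Computable.fst

theorem primrec_eval {F : Fin a → ℕ → ℕ} (hF : ∀ j, Primrec (F j)) [Primcodable α]
    (P : Scheme a n) {v : Fin n → α → ℕ} (hv : ∀ i, Primrec (v i)) :
    Primrec fun x => P.eval F (fun i => v i x) := by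
  induction P generalizing α with
  | zero => exact Primrec.const 0
  | succ => exact Primrec.succ.comp (hv 0)
  | proj i => exact hv i
  | oracle j => exact (hF j).comp (hv 0)
  | comp P Q ihP ihQ => exact ihP fun i => ihQ i hv
  | prec P Q ihP ihQ =>
    refine Primrec.nat_rec' (f := v 0) (g := fun x => P.eval F (fun i => v i.succ x))
      (h := fun x p => Q.eval F (Fin.cons p.1 (Fin.cons p.2 fun i => v i.succ x)))
      (hv 0) (ihP fun i => hv i.succ) ?_
    have := ihQ (α := α × ℕ × ℕ) (v := Fin.cons (fun p => p.2.1) (Fin.cons (fun p => p.2.2)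
      fun i p => v i.succ p.1)) ?_
    · refine this.of_eq fun p => eval_congr _ _ fun i => ?_
      refine Fin.cases rfl (fun i => Fin.cases rfl (fun i => rfl) i) i
    · refine fun i => Fin.cases ?_ (fun i => Fin.cases ?_ (fun i => ?_) i) i
      · exact Primrec.fst.comp Primrec.snd
      · exact Primrec.snd.comp Primrec.snd
      · exact (hv i.succ).comp Primrec.fst

/-- A function of two arguments, one of them in a discrete space, is continuous if its sections
are. -/
theorem _root_.Continuous.section_apply {β γ : Type*} [TopologicalSpace α] [TopologicalSpace β]
    [DiscreteTopology β] [TopologicalSpace γ] {f : β → α → γ} (hf : ∀ y, Continuous (f y))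
    {g : α → β} (hg : Continuous g) : Continuous fun x => f (g x) x :=
  (continuous_prod_of_discrete_left.2 hf : Continuous fun p : β × α => f p.1 p.2).comp
    (hg.prodMk continuous_id)

/-- A computation consults only finitely many oracle values. The number of steps of a recursion
varies with `x` but is locally constant, so it may be held fixed, and then induction on it applies.
-/
theorem continuous_eval [TopologicalSpace α] {F : α → Fin a → ℕ → ℕ} (hF : Continuous F)
    (P : Scheme a n) {v : Fin n → α → ℕ} (hv : ∀ i, Continuous (v i)) :
    Continuous fun x => P.eval (F x) (fun i => v i x) := by
  induction P with
  | zero => exact continuous_const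
  | succ => exact continuous_of_discreteTopology.comp (hv 0)
  | proj i => exact hv i
  | oracle j =>
    exact Continuous.section_apply (f := fun y x => F x j y) (fun y => by fun_prop) (hv 0)
  | comp P Q ihP ihQ => exact ihP fun i => ihQ i hv
  | prec P Q ihP ihQ =>
    refine Continuous.section_apply (f := fun y x => Nat.rec (motive := fun _ => ℕ)
      (P.eval (F x) fun i => v i.succ x)
      (fun y r => Q.eval (F x) (Fin.cons y (Fin.cons r fun i => v i.succ x))) y) (fun y => ?_) (hv 0)
    induction y with
    | zero => exact ihP fun i => hv i.succ
    | succ y ih =>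
      have := ihQ (v := Fin.cons (fun _ => y) (Fin.cons _ fun i x => v i.succ x))
        (fun i => Fin.cases continuous_const
          (fun i => Fin.cases ih (fun i => hv i.succ) i) i)
      refine this.congr fun x => eval_congr _ _ fun i => ?_
      refine Fin.cases rfl (fun i => Fin.cases rfl (fun i => rfl) i) i

end Scheme

/-! ### Primitive recursive bounds -/

theorem exists_monotone_primrec_bound {b : ℕ → ℕ} (hb : Primrec b) :
    ∃ B : ℕ → ℕ, Primrec B ∧ Monotone B ∧ ∀ x, b x ≤ B x := by
  refine ⟨fun x => Nat.rec (motive := fun _ => ℕ) (b 0) (fun y r => max r (b (y + 1))) x, ?_, ?_,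
    ?_⟩
  · refine Primrec.nat_rec₁ (f := fun y r => max r (b (y + 1))) _ ?_
    exact Primrec.nat_max.comp Primrec.snd (hb.comp (Primrec.succ.comp Primrec.fst))
  · exact monotone_nat_of_le_succ fun n => le_max_left _ _
  · intro x
    cases x with
    | zero => exact le_rfl
    | succ x => exact le_max_right _ _

theorem exists_common_monotone_primrec_bound {m : ℕ} {B : Fin m → ℕ → ℕ}
    (hB : ∀ i, Primrec (B i) ∧ Monotone (B i)) :
    ∃ C : ℕ → ℕ, Primrec C ∧ Monotone C ∧ ∀ i x, B i x ≤ C x := by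
  induction m with
  | zero => exact ⟨fun _ => 0, Primrec.const 0, monotone_const, fun i => i.elim0⟩
  | succ m ih =>
    obtain ⟨C, hC, hCm, hle⟩ := ih fun i => hB i.succ
    refine ⟨fun x => max (B 0 x) (C x), Primrec.nat_max.comp (hB 0).1 hC, (hB 0).2.sup hCm,
      fun i x => ?_⟩
    cases i using Fin.cases with
    | zero => exact le_max_left _ _
    | succ i => exact (hle i x).trans (le_max_right _ _)

/-- Bounds that are monotone in a common bound of the arguments compose. In a recursion they are
iterated. -/
theorem Scheme.exists_bound {a n : ℕ} {F : Fin a → ℕ → ℕ} (hF : ∀ j, PRBounded (F j))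
    (P : Scheme a n) :
    ∃ B : ℕ → ℕ, Primrec B ∧ Monotone B ∧ ∀ m v, (∀ i, v i ≤ m) → P.eval F v ≤ B m := by
  induction P with
  | zero => exact ⟨fun _ => 0, Primrec.const 0, monotone_const, fun _ _ _ => le_rfl⟩
  | succ => exact ⟨_, Primrec.succ, fun _ _ h => Nat.succ_le_succ h, fun m v h => Nat.succ_le_succ (h 0)⟩
  | proj i => exact ⟨_, Primrec.id, monotone_id, fun m v h => h i⟩
  | oracle j =>
    obtain ⟨b, hb, hle⟩ := hF j
    obtain ⟨B, hB, hm, hbB⟩ := exists_monotone_primrec_bound hb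
    exact ⟨B, hB, hm, fun m v h => (hle _).trans ((hbB _).trans (hm (h 0)))⟩
  | comp P Q ihP ihQ =>
    obtain ⟨B, hB, hBm, hle⟩ := ihP
    choose C hC hCm hCle using ihQ
    obtain ⟨D, hD, hDm, hCD⟩ := exists_common_monotone_primrec_bound fun i => ⟨hC i, hCm i⟩
    exact ⟨fun x => B (D x), hB.comp hD, hBm.comp hDm,
      fun m v h => hle _ _ fun i => (hCle i m v h).trans (hCD i m)⟩
  | prec P Q ihP ihQ =>
    obtain ⟨B, hB, hBm, hle⟩ := ihP
    obtain ⟨C, hC, hCm, hCle⟩ := ihQ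
    have hE : Monotone fun x => x + C x := monotone_id.add hCm
    have hE' : ∀ x, x ≤ x + C x := fun x => Nat.le_add_right _ _
    have hit : Monotone fun k => (fun x => x + C x)^[k] := Function.monotone_iterate_of_id_le hE'
    -- The start `m + B m` dominates the initial value, the parameters and the recursion variable;
    -- adding `x` to `C x` keeps these bounds under iteration. At most `m` steps occur.
    refine ⟨fun m => (fun x => x + C x)^[m] (m + B m), ?_, ?_, fun m v h => ?_⟩
    · exact Primrec.nat_iterate Primrec.id (Primrec.nat_add.comp Primrec.id hB)
        (Primrec.nat_add.comp Primrec.snd (hC.comp Primrec.snd))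
    · exact fun m m' h => (hit h _).trans
        (hE.iterate m' (Nat.add_le_add h (hBm h)))
    · refine le_trans ?_ (hit (h 0) _)
      have hv : ∀ i, Fin.tail v i ≤ m := fun i => h i.succ
      have key : ∀ y ≤ m, (Nat.rec (P.eval F (Fin.tail v))
          (fun y r => Q.eval F (Fin.cons y (Fin.cons r (Fin.tail v)))) y : ℕ) ≤
            (fun x => x + C x)^[y] (m + B m) := fun y => by
        induction y with
        | zero => exact fun _ => (hle m _ hv).trans (Nat.le_add_left _ _)
        | succ y ih =>
          intro hy
          rw [Function.iterate_succ_apply']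
          have hm : m ≤ (fun x => x + C x)^[y] (m + B m) :=
            (Nat.le_add_right m (B m)).trans (Function.id_le_iterate_of_id_le hE' y _)
          refine (hCle _ _ ?_).trans (Nat.le_add_left _ _)
          refine fun i => Fin.cases ?_ (fun i => Fin.cases ?_ (fun i => ?_) i) i
          · exact (Nat.le_of_succ_le hy).trans hm
          · exact ih (Nat.le_of_succ_le hy)
          · exact (hv i).trans hm
      exact key _ (h 0)

/-! ### Closed classes of functions -/

theorem prClosed_computable_prBounded : PRClosed {h | Computable h ∧ PRBounded h} := by
  intro a P F hF
  refine ⟨P.computable_eval (fun j => (hF j).1) fun _ => Computable.id, ?_⟩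
  obtain ⟨B, hB, -, hle⟩ := P.exists_bound fun j => (hF j).2
  exact ⟨B, hB, fun x => hle x _ fun _ => le_rfl⟩

/-- The functions that are primitive recursive in finitely many of the functions `F 0, F 1, …`. -/
def prSpan (F : ℕ → ℕ → ℕ) : Set (ℕ → ℕ) :=
  {f | ∃ (a : ℕ) (P : Scheme a 1), f = fun x => P.eval (fun j => F j) (fun _ => x)}

theorem prClosed_prSpan (F : ℕ → ℕ → ℕ) : PRClosed (prSpan F) := by
  intro a P G hG
  choose c Q hQ using hG
  -- All the `Q j` are rewritten over a common initial segment of `F`, long enough for each of them.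
  refine ⟨Finset.univ.sup c, P.substOracle fun j => (Q j).substOracle fun i =>
    .oracle (i.castLE (Finset.le_sup (Finset.mem_univ j))), ?_⟩
  funext x
  rw [Scheme.eval_substOracle]
  congr
  funext j y
  rw [Scheme.eval_substOracle, hQ]
  rfl

theorem mem_prSpan (F : ℕ → ℕ → ℕ) (n : ℕ) : F n ∈ prSpan F :=
  ⟨n + 1, .oracle (Fin.last n), rfl⟩

theorem PRClosed.mem_of_primrec {X : Set (ℕ → ℕ)} (hX : PRClosed X) {f : ℕ → ℕ} (hf : Primrec f) :
    f ∈ X := by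
  obtain ⟨P, hP⟩ := exists_scheme_of_primrec hf
  have := hX 0 P Fin.elim0 (fun j => j.elim0)
  simpa only [hP] using this


/-! ### Substitution -/

theorem Term.value_subst (S : Model) {k k' n n' : ℕ} (ρ : Fin k → Fin k') (σ : Fin n → Term k' n')
    (F : Fin k' → S.X) (v : Fin n' → S.M) (t : Term k n) :
    (t.subst ρ σ).value S F v = t.value S (fun j => F (ρ j)) (fun i => (σ i).value S F v) := by
  induction t with
  | var i => rfl
  | zero => rfl
  | succ t ih => exact congrArg S.succ ih
  | app f t ih => exact congrArg _ ih
  | fn P G ts ih => exact congrArg (S.fn P _) (funext ih)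

theorem Term.value_lift (S : Model) {k n : ℕ} (t : Term k n) (F : Fin k → S.X) (v : Fin n → S.M)
    (x : S.M) : t.lift.value S F (Fin.cons x v) = t.value S F v :=
  t.value_subst S _ _ _ _

theorem Term.value_liftF (S : Model) {k n : ℕ} (t : Term k n) (F : Fin k → S.X) (v : Fin n → S.M)
    (f : S.X) : t.liftF.value S (Fin.cons f F) v = t.value S F v :=
  t.value_subst S _ _ _ _

theorem Formula.holds_subst (S : Model) {k n : ℕ} (φ : Formula k n) {k' n' : ℕ}
    (ρ : Fin k → Fin k') (σ : Fin n → Term k' n') (F : Fin k' → S.X) (v : Fin n' → S.M) :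
    (φ.subst ρ σ).Holds S F v ↔ φ.Holds S (fun j => F (ρ j)) (fun i => (σ i).value S F v) := by
  induction φ generalizing k' n' with
  | eq t u => simp only [subst, Holds, Term.value_subst]
  | lt t u => simp only [subst, Holds, Term.value_subst]
  | neg φ ih => simp only [subst, Holds, ih]
  | and φ ψ ih ih' => simp only [subst, Holds, ih, ih']
  | or φ ψ ih ih' => simp only [subst, Holds, ih, ih']
  | imp φ ψ ih ih' => simp only [subst, Holds, ih, ih']
  | all φ ih =>
    refine forall_congr' fun x => (ih _ _ _ _).trans (iff_of_eq (congrArg _ (funext fun i => ?_)))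
    cases i using Fin.cases with
    | zero => rfl
    | succ i => exact Term.value_lift S _ F v x
  | ex φ ih =>
    refine exists_congr fun x => (ih _ _ _ _).trans (iff_of_eq (congrArg _ (funext fun i => ?_)))
    cases i using Fin.cases with
    | zero => rfl
    | succ i => exact Term.value_lift S _ F v x
  | allF φ ih =>
    refine forall_congr' fun f => (ih _ _ _ _).trans (iff_of_eq (congr (congrArg _ (funext fun j =>
      ?_)) (funext fun i => Term.value_liftF S _ F v f)))
    cases j using Fin.cases <;> rfl
  | exF φ ih =>
    refine exists_congr fun f => (ih _ _ _ _).trans (iff_of_eq (congr (congrArg _ (funext fun j =>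
      ?_)) (funext fun i => Term.value_liftF S _ F v f)))
    cases j using Fin.cases <;> rfl

theorem Formula.holds_liftF (S : Model) {k n : ℕ} (φ : Formula k n) (F : Fin k → S.X)
    (v : Fin n → S.M) (f : S.X) : φ.liftF.Holds S (Fin.cons f F) v ↔ φ.Holds S F v :=
  φ.holds_subst S _ _ _ _

theorem Formula.holds_inst (S : Model) {k n : ℕ} (φ : Formula k (n + 1)) (t : Term k n)
    (F : Fin k → S.X) (v : Fin n → S.M) :
    (φ.inst t).Holds S F v ↔ φ.Holds S F (Fin.cons (t.value S F v) v) := by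
  refine (φ.holds_subst S _ _ _ _).trans (iff_of_eq (congrArg _ (funext fun i => ?_)))
  cases i using Fin.cases <;> rfl

theorem Formula.holds_next (S : Model) {k n : ℕ} (φ : Formula k (n + 1)) (F : Fin k → S.X)
    (v : Fin n → S.M) (x : S.M) :
    φ.next.Holds S F (Fin.cons x v) ↔ φ.Holds S F (Fin.cons (S.succ x) v) := by
  refine (φ.holds_subst S _ _ _ _).trans (iff_of_eq (congrArg _ (funext fun i => ?_)))
  cases i using Fin.cases <;> rfl

/-! ### Standard models -/

theorem holds_indAxiom_standard (X : Set (ℕ → ℕ)) {k n : ℕ} (φ : Formula k (n + 1))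
    (F : Fin k → (standard X).X) (v : Fin n → (standard X).M) :
    (indAxiom φ).Holds (standard X) F v := by
  rintro ⟨h0, hs⟩ x
  rw [Formula.holds_inst] at h0
  change ℕ at x
  induction x with
  | zero => exact h0
  | succ x ih => exact (Formula.holds_next _ _ _ _ _).1 (hs x ih)

theorem standard_models_fullInduction (X : Set (ℕ → ℕ)) : (standard X).Models FullInduction := by
  rintro _ ⟨k, n, φ, rfl⟩ F v
  exact holds_indAxiom_standard X φ F v

theorem standard_models_iSigma01 (X : Set (ℕ → ℕ)) : (standard X).Models ISigma01 := by
  rintro _ ⟨k, n, φ, -, rfl⟩ F v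
  exact holds_indAxiom_standard X φ F v

/-- Standard numbers are values of constant schemes, so number parameters can be built into the
scheme. -/
theorem PRClosed.eval_mem {X : Set (ℕ → ℕ)} (hX : PRClosed X) {a m : ℕ} (P : Scheme a (m + 1))
    {F : Fin a → ℕ → ℕ} (hF : ∀ j, F j ∈ X) (v : Fin m → ℕ) :
    (fun x => P.eval F (Fin.cons x v)) ∈ X := by
  have := hX a (.comp P (Fin.cons (.proj 0) fun i => .const (v i))) F hF
  refine (congrArg (· ∈ X) (funext fun x => ?_)).mp this
  rw [Scheme.eval_comp]
  refine Scheme.eval_congr _ _ fun i => ?_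
  cases i using Fin.cases with
  | zero => rfl
  | succ i => exact Scheme.eval_const _ _ _

theorem PRClosed.models_PRA2 {X : Set (ℕ → ℕ)} (hX : PRClosed X) : (standard X).Models PRA2 := by
  rintro ⟨k, n, φ⟩ h F v
  change PRA2Axiom φ at h
  change φ.Holds (standard X) F v
  cases h with
  | zero_ne_succ => exact fun h => Nat.succ_ne_zero _ h.symm
  | succ_inj => exact Nat.succ.inj
  | not_lt_zero => exact Nat.not_lt_zero _
  | lt_succ => exact ⟨Nat.lt_succ_iff_lt_or_eq.1, Nat.lt_succ_iff_lt_or_eq.2⟩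
  | def_zero => rfl
  | def_succ => rfl
  | def_proj => rfl
  | def_oracle => rfl
  | def_comp => rfl
  | def_prec_zero P Q =>
    simp only [Formula.Holds, Term.value]
    rfl
  | def_prec_succ P Q =>
    simp only [Formula.Holds, Term.value]
    rw [Scheme.eval]
    refine Scheme.eval_congr _ Q fun i => ?_
    refine Fin.cases rfl (fun i => Fin.cases rfl (fun i => rfl) i) i
  | exists_fun P =>
    refine ⟨⟨_, hX.eval_mem P (fun j => (F j).2) v⟩, fun x => ?_⟩
    change P.eval _ _ = P.eval _ _
    exact Scheme.eval_congr _ P fun i => rfl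
  | ind θ _ => exact holds_indAxiom_standard X θ F v

/-! ### Schemes for arithmetical formulas -/

theorem Term.exists_scheme {k n : ℕ} (t : Term k n) : ∃ P : Scheme k n, ∀ (X : Set (ℕ → ℕ))
    (F : Fin k → (standard X).X) (v : Fin n → ℕ),
    t.value (standard X) F v = P.eval (fun j => (F j).1) v := by
  induction t with
  | var i => exact ⟨.proj i, fun _ _ _ => rfl⟩
  | zero => exact ⟨.const 0, fun _ _ _ => (Scheme.eval_const _ _ _).symm⟩
  | succ t ih =>
    obtain ⟨P, hP⟩ := ih
    exact ⟨.comp .succ fun _ => P, fun X F v => congrArg Nat.succ (hP X F v)⟩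
  | app f t ih =>
    obtain ⟨P, hP⟩ := ih
    exact ⟨.comp (.oracle f) fun _ => P, fun X F v => congrArg (F f).1 (hP X F v)⟩
  | fn P G ts ih =>
    choose Q hQ using ih
    refine ⟨.comp (P.substOracle fun j => .oracle (G j)) Q, fun X F v => ?_⟩
    rw [Scheme.eval_comp, Scheme.eval_substOracle]
    exact Scheme.eval_congr _ P fun i => hQ i X F v

/-- Truth is coded by the value `0`: conjunction becomes a sum, disjunction a product, and bounded
quantifiers become bounded sums and products. The scheme works uniformly in `X` and the parameters.
-/
theorem IsDelta0.exists_scheme {k n : ℕ} {φ : Formula k n} (hφ : IsDelta0 φ) :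
    ∃ P : Scheme k n, ∀ (X : Set (ℕ → ℕ)) (F : Fin k → (standard X).X) (v : Fin n → ℕ),
      φ.Holds (standard X) F v ↔ P.eval (fun j => (F j).1) v = 0 := by
  induction hφ with
  | eq t u =>
    obtain ⟨P, hP⟩ := t.exists_scheme
    obtain ⟨Q, hQ⟩ := u.exists_scheme
    refine ⟨.op .add (.op .rsub P Q) (.op .rsub Q P), fun X F v => ?_⟩
    simp only [Formula.Holds, hP, hQ, Scheme.eval_op, Scheme.eval_add, Scheme.eval_rsub,
      Matrix.cons_val_zero, Matrix.cons_val_one]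
    omega
  | lt t u =>
    obtain ⟨P, hP⟩ := t.exists_scheme
    obtain ⟨Q, hQ⟩ := u.exists_scheme
    refine ⟨.op .rsub Q (.op .add (.const 1) P), fun X F v => ?_⟩
    simp only [Formula.Holds, hP, hQ, Scheme.eval_op, Scheme.eval_add, Scheme.eval_rsub,
      Matrix.cons_val_zero, Matrix.cons_val_one, Scheme.eval_const]
    omega
  | neg _ ih =>
    obtain ⟨P, hP⟩ := ih
    refine ⟨.op .rsub P (.const 1), fun X F v => ?_⟩
    simp only [Formula.Holds, hP, Scheme.eval_op, Scheme.eval_rsub,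
      Matrix.cons_val_zero, Matrix.cons_val_one, Scheme.eval_const]
    omega
  | and _ _ ih ih' =>
    obtain ⟨P, hP⟩ := ih
    obtain ⟨Q, hQ⟩ := ih'
    refine ⟨.op .add P Q, fun X F v => ?_⟩
    simp [Formula.Holds, hP, hQ]
  | or _ _ ih ih' =>
    obtain ⟨P, hP⟩ := ih
    obtain ⟨Q, hQ⟩ := ih'
    refine ⟨.op .mul P Q, fun X F v => ?_⟩
    simp [Formula.Holds, hP, hQ]
  | imp _ _ ih ih' =>
    obtain ⟨P, hP⟩ := ih
    obtain ⟨Q, hQ⟩ := ih'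
    refine ⟨.op .mul (.op .rsub P (.const 1)) Q, fun X F v => ?_⟩
    simp only [Formula.Holds, hP, hQ, Scheme.eval_op, Scheme.eval_mul, Scheme.eval_rsub,
      Matrix.cons_val_zero, Matrix.cons_val_one, Scheme.eval_const, mul_eq_zero]
    omega
  | ball t _ ih =>
    obtain ⟨P, hP⟩ := ih
    obtain ⟨T, hT⟩ := t.exists_scheme
    refine ⟨P.sumLt.atFirst T, fun X F v => ?_⟩
    rw [Scheme.eval_atFirst, Scheme.eval_sumLt, Finset.sum_eq_zero_iff]
    refine forall_congr' fun x => imp_congr ?_ (hP X F _)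
    rw [Finset.mem_range, ← hT, ← Term.value_lift]
    rfl
  | bex t _ ih =>
    obtain ⟨P, hP⟩ := ih
    obtain ⟨T, hT⟩ := t.exists_scheme
    refine ⟨P.prodLt.atFirst T, fun X F v => ?_⟩
    rw [Scheme.eval_atFirst, Scheme.eval_prodLt, Finset.prod_eq_zero_iff]
    refine exists_congr fun x => and_congr ?_ (hP X F _)
    rw [Finset.mem_range, ← hT, ← Term.value_lift]
    rfl

/-- The scheme that combines the first two variables into a pair. -/
def Scheme.contract {a n : ℕ} (P : Scheme a (n + 2)) : Scheme a (n + 1) :=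
  .comp P (Fin.cons (.comp Scheme.left.lift ![.proj 0])
    (Fin.cons (.comp Scheme.right.lift ![.proj 0]) fun i => .proj i.succ))

theorem Scheme.eval_contract {a n : ℕ} (F : Fin a → ℕ → ℕ) (P : Scheme a (n + 2)) (z : ℕ)
    (v : Fin n → ℕ) : P.contract.eval F (Fin.cons z v : Fin (n + 1) → ℕ) =
      P.eval F (Fin.cons z.unpair.1 (Fin.cons z.unpair.2 v : Fin (n + 1) → ℕ)) := by
  rw [contract, eval_comp]
  refine Scheme.eval_congr _ _ fun i => ?_
  refine Fin.cases ?_ (fun i => Fin.cases ?_ (fun i => rfl) i) i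
  · simp [eval_comp, eval]
  · simp [eval_comp, eval]

/-- Pairing merges a block of quantifiers into one; a `Δ⁰₀` formula receives a dummy variable. -/
theorem IsSigma1.exists_scheme {k n : ℕ} {φ : Formula k n} (hφ : IsSigma1 φ) :
    ∃ P : Scheme k (n + 1), ∀ (X : Set (ℕ → ℕ)) (F : Fin k → (standard X).X) (v : Fin n → ℕ),
      φ.Holds (standard X) F v ↔ ∃ z, P.eval (fun j => (F j).1) (Fin.cons z v) = 0 := by
  induction hφ with
  | of h =>
    obtain ⟨P, hP⟩ := h.exists_scheme
    refine ⟨.comp P fun i => .proj i.succ, fun X F v => ?_⟩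
    simp [hP, Scheme.eval]
  | ex _ ih =>
    obtain ⟨P, hP⟩ := ih
    refine ⟨P.contract, fun X F v => ?_⟩
    simp only [Formula.Holds, hP, Scheme.eval_contract]
    refine ⟨fun ⟨x, z, h⟩ => ⟨Nat.pair z x, ?_⟩, fun ⟨z, h⟩ => ⟨_, _, h⟩⟩
    rwa [Nat.unpair_pair]

theorem IsPi1.exists_scheme {k n : ℕ} {φ : Formula k n} (hφ : IsPi1 φ) :
    ∃ P : Scheme k (n + 1), ∀ (X : Set (ℕ → ℕ)) (F : Fin k → (standard X).X) (v : Fin n → ℕ),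
      φ.Holds (standard X) F v ↔ ∀ z, P.eval (fun j => (F j).1) (Fin.cons z v) = 0 := by
  induction hφ with
  | of h =>
    obtain ⟨P, hP⟩ := h.exists_scheme
    refine ⟨.comp P fun i => .proj i.succ, fun X F v => ?_⟩
    simp [hP, Scheme.eval]
  | all _ ih =>
    obtain ⟨P, hP⟩ := ih
    refine ⟨P.contract, fun X F v => ?_⟩
    simp only [Formula.Holds, hP, Scheme.eval_contract]
    refine ⟨fun h z => h _ _, fun h x z => ?_⟩
    simpa using h (Nat.pair z x)

/-! ### Comprehension in standard models -/

theorem holds_compAxiom_standard (X : Set (ℕ → ℕ)) {k n : ℕ} (φ ψ : Formula k (n + 1))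
    (F : Fin k → (standard X).X) (v : Fin n → ℕ) :
    (compAxiom φ ψ).Holds (standard X) F v ↔
      ((∀ x : ℕ, φ.Holds (standard X) F (Fin.cons x v) ↔ ψ.Holds (standard X) F (Fin.cons x v)) →
        ∃ f ∈ X, ∀ x, (φ.Holds (standard X) F (Fin.cons x v) → f x = 1) ∧
          (¬ φ.Holds (standard X) F (Fin.cons x v) → f x = 0)) := by
  have h1 : (∀ x : ℕ, (φ.iff ψ).Holds (standard X) F (Fin.cons x v)) ↔
      ∀ x : ℕ, φ.Holds (standard X) F (Fin.cons x v) ↔ ψ.Holds (standard X) F (Fin.cons x v) :=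
    forall_congr' fun x => iff_iff_implies_and_implies.symm
  refine imp_congr h1 ⟨fun ⟨f, hf⟩ => ⟨f.1, f.2, fun x => ?_⟩, fun ⟨f, hX, hf⟩ => ⟨⟨f, hX⟩,
    fun x => ?_⟩⟩
  · refine (hf x).imp (fun h hφ => h ?_) (fun h hφ => h fun hφ' => hφ ?_)
    · exact (Formula.holds_liftF _ _ _ _ _).2 hφ
    · exact (Formula.holds_liftF _ _ _ _ _).1 hφ'
  · refine (hf x).imp (fun h hφ => h ?_) (fun h hφ => h fun hφ' => hφ ?_)
    · exact (Formula.holds_liftF _ _ _ _ _).1 hφ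
    · exact (Formula.holds_liftF _ _ _ _ _).2 hφ'

/-- If the zeros of two computable functions separate the cases of a predicate, then there is a
computable characteristic function. -/
theorem exists_computable_char {A B : ℕ × ℕ → ℕ} (hA : Computable A) (hB : Computable B)
    {p : ℕ → Prop} (hp : ∀ x, p x ↔ ∃ z, A (z, x) = 0) (hn : ∀ x, ¬ p x ↔ ∃ z, B (z, x) ≠ 0) :
    ∃ f : ℕ → ℕ, Computable f ∧ (∀ x, f x ≤ 1) ∧ ∀ x, (p x → f x = 1) ∧ (¬ p x → f x = 0) := by
  -- Witnesses for `p x` and for `¬ p x` are sought simultaneously, so the search terminates; the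
  -- kind of witness found decides `p x`.
  have hex : ∀ x, ∃ z, A (z, x) = 0 ∨ B (z, x) ≠ 0 := fun x => by
    by_cases h : p x
    · exact ((hp x).1 h).imp fun _ => Or.inl
    · exact ((hn x).1 h).imp fun _ => Or.inr
  let f : ℕ → ℕ := fun x => if A (Nat.find (hex x), x) = 0 then 1 else 0
  have hfind : Computable fun x => Nat.find (hex x) := by
    have hc : Computable₂ fun (x z : ℕ) => decide (A (z, x) = 0 ∨ B (z, x) ≠ 0) := by
      have h1 : PrimrecPred fun q : ℕ × ℕ => q.1 = 0 ∨ q.2 ≠ 0 :=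
        (Primrec.eq.comp Primrec.fst (Primrec.const 0)).or
          (Primrec.eq.comp Primrec.snd (Primrec.const 0)).not
      have hsw : Computable fun q : ℕ × ℕ => (q.2, q.1) := Computable.snd.pair Computable.fst
      obtain ⟨_, h2⟩ := h1
      refine (h2.to_comp.comp ((hA.comp hsw).pair (hB.comp hsw))).of_eq fun q => ?_
      simp
    refine (Partrec.rfind hc.partrec₂).of_eq fun x => ?_
    refine Part.eq_some_iff.2 (Nat.mem_rfind.2 ⟨?_, fun {m} hm => ?_⟩)
    · simpa using Nat.find_spec (hex x)
    · simpa using Nat.find_min (hex x) hm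
  refine ⟨f, ?_, fun x => ?_, fun x => ⟨fun h => if_pos ?_, fun h => if_neg ?_⟩⟩
  · have h0 : Primrec fun y : ℕ => if y = 0 then 1 else 0 :=
      Primrec.ite (Primrec.eq.comp Primrec.id (Primrec.const 0)) (Primrec.const 1)
        (Primrec.const 0)
    exact h0.to_comp.comp (hA.comp (hfind.pair Computable.id))
  · simp only [f]
    split_ifs <;> simp
  · refine (Nat.find_spec (hex x)).resolve_right fun hB => (hn x).2 ⟨_, hB⟩ h
  · exact fun hA => h ((hp x).2 ⟨_, hA⟩)

theorem standard_models_delta01CA :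
    (standard {h | Computable h ∧ PRBounded h}).Models Delta01CA := by
  rintro _ ⟨k, n, φ, ψ, hφ, hψ, rfl⟩ F v
  refine (holds_compAxiom_standard _ φ ψ F v).2 fun hiff => ?_
  obtain ⟨P, hP⟩ := hφ.exists_scheme
  obtain ⟨Q, hQ⟩ := hψ.exists_scheme
  have hc : ∀ R : Scheme k (n + 2), Computable fun p : ℕ × ℕ =>
      R.eval (fun j => (F j).1) (Fin.cons p.1 (Fin.cons p.2 v)) := fun R => by
    refine (R.computable_eval (fun j => (F j).2.1) (v := Fin.cons Prod.fst (Fin.cons Prod.snd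
      fun i _ => v i)) ?_).of_eq fun p => Scheme.eval_congr _ _ fun i => ?_
    · exact fun i => Fin.cases Computable.fst (fun i => Fin.cases Computable.snd
        (fun i => Computable.const _) i) i
    · exact Fin.cases rfl (fun i => Fin.cases rfl (fun i => rfl) i) i
  obtain ⟨f, hf, hf1, hf2⟩ := exists_computable_char (hc P) (hc Q)
    (p := fun x => φ.Holds _ F (Fin.cons x v)) (fun x => hP _ F _) fun x => by
      rw [hiff, hQ, not_forall]
  exact ⟨f, ⟨hf, fun _ => 1, Primrec.const 1, hf1⟩, hf2⟩


/-! ### The Baire Category Theorem in standard models -/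

/-- The string with code `c`. -/
abbrev strOf (c : ℕ) : List ℕ := Denumerable.ofNat (List ℕ) c

theorem strOf_encode (l : List ℕ) : strOf (Encodable.encode l) = l := Denumerable.ofNat_encode l

theorem encode_eq_zero_iff (l : List ℕ) : Encodable.encode l = 0 ↔ l = [] := by
  cases l <;> simp

theorem Term.value_pairT (X : Set (ℕ → ℕ)) {k n : ℕ} (t u : Term k n) (F : Fin k → (standard X).X)
    (v : Fin n → ℕ) : (pairT t u).value (standard X) F v =
      Nat.pair (t.value (standard X) F v) (u.value (standard X) F v) := by
  simp [pairT, Term.value]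

theorem Term.value_entryT (X : Set (ℕ → ℕ)) {k n : ℕ} (i s : Term k n)
    (F : Fin k → (standard X).X) (v : Fin n → ℕ)
    (h : i.value (standard X) F v < (strOf (s.value (standard X) F v)).length) :
    (entryT i s).value (standard X) F v =
      (strOf (s.value (standard X) F v))[i.value (standard X) F v] :=
  Scheme.eval_entry _ _ _ (Denumerable.encode_ofNat _).symm h

theorem holds_ltLength (X : Set (ℕ → ℕ)) {k n : ℕ} (i s : Term k n) (F : Fin k → (standard X).X)
    (v : Fin n → ℕ) : (ltLength i s).Holds (standard X) F v ↔
      i.value (standard X) F v < (strOf (s.value (standard X) F v)).length := by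
  simp only [ltLength, Formula.Holds, Term.value]
  rw [Scheme.eval_drop _ _ (strOf (s.value (standard X) F v)) (Denumerable.encode_ofNat _).symm,
    encode_eq_zero_iff, List.drop_eq_nil_iff]
  simp

theorem holds_extends (X : Set (ℕ → ℕ)) {k n : ℕ} (s t : Term k n) (F : Fin k → (standard X).X)
    (v : Fin n → ℕ) : (extends_ s t).Holds (standard X) F v ↔
      strOf (s.value (standard X) F v) <+: strOf (t.value (standard X) F v) := by
  rw [List.prefix_iff_getElem]
  have h : (extends_ s t).Holds (standard X) F v ↔ ∀ i : ℕ,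
      (ltLength (.var 0) s.lift).Holds (standard X) F (Fin.cons i v) →
      (ltLength (.var 0) t.lift).Holds (standard X) F (Fin.cons i v) ∧
      (entryT (.var 0) t.lift).value (standard X) F (Fin.cons i v) =
      (entryT (.var 0) s.lift).value (standard X) F (Fin.cons i v) := Iff.rfl
  simp only [h, holds_ltLength, Term.value_lift]
  refine ⟨fun h => ?_, fun ⟨hle, h⟩ i hi => ⟨lt_of_lt_of_le hi hle, ?_⟩⟩
  · have hle : (strOf (s.value (standard X) F v)).length ≤
        (strOf (t.value (standard X) F v)).length := by
      by_contra! hlt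
      exact lt_irrefl _ (h _ hlt).1
    refine ⟨hle, fun i hi => ?_⟩
    have := (h i hi).2
    rw [Term.value_entryT, Term.value_entryT] at this
    · simp only [Term.value_lift] at this
      exact this.symm
    · rw [Term.value_lift]; exact hi
    · rw [Term.value_lift]; exact lt_of_lt_of_le hi hle
  · rw [Term.value_entryT, Term.value_entryT]
    · simp only [Term.value_lift]
      exact (h i hi).symm
    · rw [Term.value_lift]; exact hi
    · rw [Term.value_lift]; exact lt_of_lt_of_le hi hle

theorem holds_inBasic (X : Set (ℕ → ℕ)) {k n : ℕ} (s : Term k n) (h : Fin k)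
    (F : Fin k → (standard X).X) (v : Fin n → ℕ) : (inBasic s h).Holds (standard X) F v ↔
      ∀ (i : ℕ) (hi : i < (strOf (s.value (standard X) F v)).length),
        (F h).1 i = (strOf (s.value (standard X) F v))[i] := by
  have H : (inBasic s h).Holds (standard X) F v ↔ ∀ i : ℕ,
      (ltLength (.var 0) s.lift).Holds (standard X) F (Fin.cons i v) →
      (F h).1 i = (entryT (.var 0) s.lift).value (standard X) F (Fin.cons i v) := Iff.rfl
  simp only [H, holds_ltLength, Term.value_lift]
  refine forall_congr' fun i => forall_congr' fun hi => ?_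
  rw [Term.value_entryT]
  · simp only [Term.value_lift]
    rfl
  · rw [Term.value_lift]; exact hi

/-- The sequence of lists of strings that is coded by `w`. -/
abbrev openSeq (w : ℕ → ℕ) (n k : ℕ) : List ℕ := strOf (w (Nat.pair n k))

/-- Every number codes exactly one list, so over `ω` quantifying over codes is the same as
quantifying over strings. -/
theorem standard_models_BCT_iff (X : Set (ℕ → ℕ)) : (standard X).Models BCT ↔
    ∀ w ∈ X, IsInstance (openSeq w) → ∃ h ∈ X, IsSolution (openSeq w) h := by
  have H : (standard X).Models BCT ↔ ∀ w : X,
      (∀ n c : ℕ, ∃ k t : ℕ, strOf c <+: strOf t ∧ openSeq w.1 n k <+: strOf t) →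
      ∃ h : X, IsSolution (openSeq w.1) h.1 := by
    refine ⟨fun h w hw => ?_, ?_⟩
    · have hs : BCTSentence.Holds (standard X) Fin.elim0 Fin.elim0 := h _ rfl _ _
      obtain ⟨g, hg⟩ := hs w fun n c => by
        obtain ⟨k, t, h1, h2⟩ := hw n c
        refine ⟨k, t, (holds_extends _ _ _ _ _).2 h1, (holds_extends _ _ _ _ _).2 ?_⟩
        simp only [Term.value, Term.value_pairT]
        exact h2
      refine ⟨g, fun n => ?_⟩
      obtain ⟨k, hk⟩ := hg n
      have := (holds_inBasic _ _ _ _ _).1 hk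
      simp only [Term.value, Term.value_pairT] at this
      exact ⟨k, this⟩
    · rintro h _ rfl F v w hw
      obtain ⟨g, hg⟩ := h w fun n c => by
        obtain ⟨k, t, h1, h2⟩ := hw n c
        have h1' := (holds_extends _ _ _ _ _).1 h1
        have h2' := (holds_extends _ _ _ _ _).1 h2
        simp only [Term.value, Term.value_pairT] at h2'
        exact ⟨k, t, h1', h2'⟩
      refine ⟨g, fun n => ?_⟩
      obtain ⟨k, hk⟩ := hg n
      refine ⟨k, (holds_inBasic _ _ _ _ _).2 ?_⟩
      simp only [Term.value, Term.value_pairT]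
      exact hk
  rw [H, Subtype.forall]
  refine forall_congr' fun w => forall_congr' fun hw => imp_congr
    ⟨fun h n σ => ?_, fun h n c => ?_⟩ (Subtype.exists.trans (by simp only [exists_prop]))
  · obtain ⟨k, t, h1, h2⟩ := h n (Encodable.encode σ)
    rw [strOf_encode] at h1
    exact ⟨k, _, h1, h2⟩
  · obtain ⟨k, τ, h1, h2⟩ := h n (strOf c)
    refine ⟨k, Encodable.encode τ, ?_⟩
    rw [strOf_encode]
    exact ⟨h1, h2⟩

/-! ### An instance without primitive recursively bounded solutions -/

/-- Requirement `n = ⟨m, s⟩` is void unless `ack m 0` is computed within bound `s`; otherwise every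
listed string exceeds `ack m` at some argument. Every primitive recursive function lies below some
`ack m`. -/
theorem exists_primrec_instance : ∃ V : ℕ → ℕ → List ℕ, Primrec₂ V ∧ IsInstance V ∧
    ∀ h : ℕ → ℕ, IsSolution V h → ¬ PRBounded h := by
  obtain ⟨c, hc⟩ := Nat.Partrec.Code.exists_code.1
    (Partrec.nat_iff.1 ((computable₂_ack.comp (Computable.fst.comp Computable.unpair)
      (Computable.snd.comp Computable.unpair)).partrec))
  have hc' : ∀ {s m x y : ℕ}, c.evaln s (Nat.pair m x) = some y → y = ack m x := fun h => by
    have := Nat.Partrec.Code.evaln_sound (Option.mem_def.2 h)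
    simpa [hc] using this
  have hex : ∀ m x : ℕ, ∃ s, c.evaln s (Nat.pair m x) = some (ack m x) := fun m x =>
    Nat.Partrec.Code.evaln_complete.1 (by simp [hc])
  let E : ℕ → ℕ → ℕ → Option ℕ := fun m x s => c.evaln s (Nat.pair m x)
  -- Here `k = ⟨σ, r⟩`. If `r` suffices to compute `ack m` at the length of `σ`, then `σ` is
  -- extended by a larger value. Otherwise some string must still be listed; the default `[y0 + 1]`
  -- already exceeds `ack m` at `0`. Having `y0` available for it is the purpose of `s`.
  let V : ℕ → ℕ → List ℕ := fun n k =>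
    (E n.unpair.1 0 n.unpair.2).elim [] fun y0 =>
      (E n.unpair.1 (strOf k.unpair.1).length k.unpair.2).elim [y0 + 1] fun y =>
        strOf k.unpair.1 ++ [y + 1]
  have hE : ∀ {α : Type} [Primcodable α] {f g r : α → ℕ}, Primrec f → Primrec g → Primrec r →
      Primrec fun x => E (f x) (g x) (r x) := fun hf hg hr =>
    Nat.Partrec.Code.primrec_evaln.comp ((hr.pair (Primrec.const c)).pair
      (Primrec₂.natPair.comp hf hg))
  have hu1 : Primrec fun x : ℕ => x.unpair.1 := Primrec.fst.comp Primrec.unpair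
  have hu2 : Primrec fun x : ℕ => x.unpair.2 := Primrec.snd.comp Primrec.unpair
  have hstr : Primrec fun x : ℕ => strOf x.unpair.1 := (Primrec.ofNat (List ℕ)).comp hu1
  have hs1 : Primrec fun y : ℕ => [y + 1] :=
    Primrec.list_cons.comp Primrec.succ (Primrec.const [])
  refine ⟨V, ?_, fun n σ => ?_, fun h hsol ⟨b, hb, hle⟩ => ?_⟩
  · have h2 : Primrec₂ fun (p : ℕ × ℕ) (y0 : ℕ) =>
        (Option.casesOn (E p.1.unpair.1 (strOf p.2.unpair.1).length p.2.unpair.2) [y0 + 1]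
          fun y => strOf p.2.unpair.1 ++ [y + 1] : List ℕ) := by
      refine Primrec.option_casesOn (α := (ℕ × ℕ) × ℕ) (hE ?_ ?_ ?_) (hs1.comp Primrec.snd)
        (Primrec.list_append.comp ?_ (hs1.comp Primrec.snd))
      · exact hu1.comp (Primrec.fst.comp Primrec.fst)
      · exact Primrec.list_length.comp (hstr.comp (Primrec.snd.comp Primrec.fst))
      · exact hu2.comp (Primrec.snd.comp Primrec.fst)
      · exact hstr.comp (Primrec.snd.comp (Primrec.fst.comp Primrec.fst))
    refine (Primrec.option_casesOn (hE (hu1.comp Primrec.fst) (Primrec.const 0)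
      (hu2.comp Primrec.fst)) (Primrec.const []) h2).of_eq fun p => ?_
    simp only [V]
    cases E p.1.unpair.1 0 p.1.unpair.2 with
    | none => rfl
    | some y0 => cases E p.1.unpair.1 (strOf p.2.unpair.1).length p.2.unpair.2 <;> rfl
  · cases h0 : E n.unpair.1 0 n.unpair.2 with
    | none => exact ⟨0, σ, List.prefix_rfl, by simp [V, h0]⟩
    | some y0 =>
      obtain ⟨s, hs⟩ := hex n.unpair.1 σ.length
      refine ⟨Nat.pair (Encodable.encode σ) s, σ ++ [ack n.unpair.1 σ.length + 1],
        List.prefix_append _ _, ?_⟩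
      simp only [V, h0, Nat.unpair_pair, strOf_encode]
      simp [E, hs]
  · obtain ⟨m, hm⟩ := exists_lt_ack_of_nat_primrec (Primrec.nat_iff.1 hb)
    have hlt : ∀ x, h x < ack m x := fun x => (hle x).trans_lt (hm x)
    obtain ⟨s0, hs0⟩ := hex m 0
    -- With `s0` large enough to compute `ack m 0`, the requirement is active, and either form of
    -- listed string contradicts `h < ack m`.
    obtain ⟨k, hk⟩ := hsol (Nat.pair m s0)
    have hE0 : E m 0 s0 = some (ack m 0) := hs0
    simp only [V, Nat.unpair_pair, hE0] at hk
    cases h1 : E m (strOf k.unpair.1).length k.unpair.2 with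
    | none =>
      have := hk 0 (by simp [h1])
      have h0 := hlt 0
      simp only [h1, Option.elim_some, Option.elim_none, List.getElem_cons_zero] at this
      omega
    | some y =>
      have := hk (strOf k.unpair.1).length (by simp [h1])
      have h0 := hlt (strOf k.unpair.1).length
      simp only [h1, Option.elim_some, hc' h1, List.getElem_concat_length] at this
      omega

theorem not_standard_models_BCT :
    ¬ (standard {h | Computable h ∧ PRBounded h}).Models BCT := by
  obtain ⟨V, hV, hinst, hsol⟩ := exists_primrec_instance
  rw [standard_models_BCT_iff]
  intro H
  have hw : Primrec fun x : ℕ => Encodable.encode (V x.unpair.1 x.unpair.2) :=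
    Primrec.encode.comp (hV.comp (Primrec.fst.comp Primrec.unpair)
      (Primrec.snd.comp Primrec.unpair))
  have hVw : openSeq (fun x : ℕ => Encodable.encode (V x.unpair.1 x.unpair.2)) = V := by
    funext n k
    rw [openSeq, strOf_encode, Nat.unpair_pair]
  obtain ⟨h, hh, hs⟩ := H _ (prClosed_computable_prBounded.mem_of_primrec hw)
    (by rwa [hVw])
  rw [hVw] at hs
  exact hsol h hs hh.2


/-! ### Countability of the set of schemes -/

/-- A numbering of schemes. -/
def Scheme.code {a : ℕ} : {n : ℕ} → Scheme a n → ℕ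
  | _, .zero => Nat.pair 0 0
  | _, .succ => Nat.pair 1 0
  | _, .proj i => Nat.pair 2 i
  | _, .oracle j => Nat.pair 3 j
  | _, .comp (m := m) P Q =>
      Nat.pair 4 (Nat.pair m (Nat.pair P.code (Encodable.encode fun i => (Q i).code)))
  | _, .prec P Q => Nat.pair 5 (Nat.pair P.code Q.code)

theorem Scheme.code_injective {a n : ℕ} : Function.Injective (Scheme.code : Scheme a n → ℕ) := by
  intro P Q h
  induction P with
  | zero => cases Q <;> simp_all [code]
  | succ => cases Q <;> simp_all [code]
  | proj i => cases Q <;> simp_all [code, Fin.ext_iff]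
  | oracle j => cases Q <;> simp_all [code, Fin.ext_iff]
  | comp P Q ihP ihQ =>
    cases Q with
    | comp P' Q' =>
      simp only [code, Nat.pair_eq_pair, true_and] at h
      obtain ⟨rfl, hP, hQ⟩ := h
      rw [ihP hP, funext fun i => ihQ i (congrFun (Encodable.encode_injective hQ) i)]
    | _ => simp [code] at h
  | prec P Q ihP ihQ =>
    cases Q with
    | prec P' Q' =>
      simp only [code, Nat.pair_eq_pair, true_and] at h
      rw [ihP h.1, ihQ h.2]
    | _ => simp [code] at h

/-- Countability leaves only countably many genericity conditions, as the Baire category theorem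
requires. -/
instance Scheme.instCountable (a n : ℕ) : Countable (Scheme a n) :=
  Scheme.code_injective.countable

/-! ### Generic sequences of functions -/

/-- The sequence `F`, cut off after the first `N` functions and the first `N` arguments. -/
def cutOff (F : ℕ → ℕ → ℕ) (N j i : ℕ) : ℕ := if j < N ∧ i < N then F j i else 0

theorem primrec_ite_lt (f : ℕ → ℕ) (N : ℕ) : Primrec fun i => if i < N then f i else 0 := by
  refine ((Primrec.list_getD 0).comp (Primrec.const (List.ofFn fun i : Fin N => f i))
    Primrec.id).of_eq fun i => ?_
  split_ifs with h <;> simp [h]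

theorem primrec_cutOff (F : ℕ → ℕ → ℕ) (N j : ℕ) : Primrec (cutOff F N j) := by
  by_cases h : j < N
  · exact (primrec_ite_lt (F j) N).of_eq fun i => by simp [cutOff, h]
  · exact (Primrec.const 0).of_eq fun i => by simp [cutOff, h]

theorem tendsto_of_eventually_eq_apply {G : ℕ → ℕ → ℕ → ℕ} {F : ℕ → ℕ → ℕ}
    (h : ∀ j i, ∀ᶠ N in Filter.atTop, G N j i = F j i) :
    Filter.Tendsto G Filter.atTop (nhds F) :=
  tendsto_pi_nhds.2 fun j => tendsto_pi_nhds.2 fun i => tendsto_nhds_of_eventually_eq (h j i)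

theorem tendsto_cutOff (F : ℕ → ℕ → ℕ) :
    Filter.Tendsto (cutOff F) Filter.atTop (nhds F) := by
  refine tendsto_of_eventually_eq_apply fun j i => ?_
  filter_upwards [Filter.eventually_gt_atTop j, Filter.eventually_gt_atTop i] with N h1 h2
  exact if_pos ⟨h1, h2⟩

/-- The value of a functional at an initial segment of a sequence of functions. -/
def Scheme.app {a : ℕ} (P : Scheme a 1) (F : ℕ → ℕ → ℕ) (x : ℕ) : ℕ :=
  P.eval (fun j => F j) (fun _ => x)

theorem Scheme.continuous_app {a : ℕ} (P : Scheme a 1) : Continuous P.app := by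
  refine continuous_pi fun x => ?_
  exact P.continuous_eval (F := fun (F : ℕ → ℕ → ℕ) (j : Fin a) => F j) (by fun_prop)
    (v := fun _ _ => x) fun _ => continuous_const

theorem isOpen_app_ne {a : ℕ} (P : Scheme a 1) (g : ℕ → ℕ) : IsOpen {F | P.app F ≠ g} :=
  isOpen_ne.preimage P.continuous_app

/-- The cut-offs of `F` converge to `F`, and on primitive recursive oracles `P` yields a primitive
recursive function, hence not `g`. -/
theorem dense_app_ne {a : ℕ} (P : Scheme a 1) {g : ℕ → ℕ} (hg : ¬ Primrec g) :
    Dense {F | P.app F ≠ g} := fun F =>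
  mem_closure_of_tendsto (tendsto_cutOff F) <| Filter.Eventually.of_forall fun N h => hg <| by
    rw [← h]
    exact P.primrec_eval (fun j => primrec_cutOff F N j) fun _ => Primrec.id

/-- The sequences `F` such that `F a` satisfies the `n`-th requirement of the instance given by
`P(F 0, …, F (a - 1))`. -/
def solvesAt {a : ℕ} (P : Scheme a 1) (n : ℕ) : Set (ℕ → ℕ → ℕ) :=
  {F | ∃ k, ∀ (i : ℕ) (hi : i < (openSeq (P.app F) n k).length),
    F a i = (openSeq (P.app F) n k)[i]}

theorem isOpen_solvesAt {a : ℕ} (P : Scheme a 1) (n : ℕ) : IsOpen (solvesAt P n) := by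
  have h : solvesAt P n = ⋃ k, ⋃ c, {F | P.app F (Nat.pair n k) = c} ∩
      ⋂ i : Fin (strOf c).length, {F | F a i = (strOf c)[i]} := by
    ext F
    simp only [Set.mem_iUnion, Set.mem_inter_iff, Set.mem_iInter, Set.mem_ofPred_eq, solvesAt]
    refine exists_congr fun k => ⟨fun h => ⟨_, rfl, fun i => h i i.2⟩, ?_⟩
    rintro ⟨_, rfl, h⟩ i hi
    exact h ⟨i, hi⟩
  rw [h]
  refine isOpen_iUnion fun k => isOpen_iUnion fun c => IsOpen.inter ?_
    (isOpen_iInter_of_finite fun i => ?_)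
  · exact (isOpen_discrete {c}).preimage ((continuous_apply _).comp P.continuous_app)
  · have hc : Continuous fun F : ℕ → ℕ → ℕ => F a i := by fun_prop
    exact (isOpen_discrete {(strOf c)[i]}).preimage hc

/-- The instance depends only on `F 0, …, F (a - 1)`, so `F a` can be changed freely. By density,
its first `N` values extend to a string that meets requirement `n`. -/
theorem mem_closure_solvesAt {a : ℕ} (P : Scheme a 1) (n : ℕ) {F : ℕ → ℕ → ℕ}
    (hF : IsInstance (openSeq (P.app F))) : F ∈ closure (solvesAt P n) := by
  choose k τ h1 h2 using fun N => hF n (List.ofFn fun i : Fin N => F a i)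
  -- Only the `a`-th function changes: it becomes `τ N` followed by zeros.
  let G : ℕ → ℕ → ℕ → ℕ := fun N => Function.update F a fun i => (τ N).getD i 0
  have hG : ∀ N, P.app (G N) = P.app F := fun N => by
    funext x
    refine congrArg (fun H => P.eval H _) (funext fun j => ?_)
    exact Function.update_of_ne j.2.ne _ _
  refine mem_closure_of_tendsto (f := G) (b := Filter.atTop)
    (tendsto_of_eventually_eq_apply fun j i => ?_) (Filter.Eventually.of_forall fun N => ?_)
  · filter_upwards [Filter.eventually_gt_atTop i] with N hN
    by_cases hj : j = a
    · subst hj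
      simp only [G, Function.update_self]
      have := (h1 N).getElem (i := i) (by simpa using hN)
      rw [List.getD_eq_getElem _ _ (by
        have := (h1 N).length_le
        rw [List.length_ofFn] at this
        omega), ← this]
      simp
    · simp only [G, Function.update_of_ne hj]
  · refine ⟨k N, fun i hi => ?_⟩
    simp only [hG] at hi ⊢
    simp only [G, Function.update_self]
    rw [(h2 N).getElem hi, List.getD_eq_getElem]

/-- There is a sequence of functions that is generic with respect to the Baire Category Theorem and
in which a given function that is not primitive recursive is not primitive recursive. -/
theorem exists_generic {g : ℕ → ℕ} (hg : ¬ Primrec g) :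
    ∃ F : ℕ → ℕ → ℕ, (standard (prSpan F)).Models BCT ∧ g ∉ prSpan F := by
  have h1 : Dense (⋂ P : Σ a, Scheme a 1, {F | P.2.app F ≠ g}) :=
    dense_iInter_of_isOpen (fun P => isOpen_app_ne P.2 g) fun P => dense_app_ne P.2 hg
  -- `solvesAt` itself need not be dense, since `P` may fail to give an instance near some `F`. But
  -- an open set has a nowhere dense frontier, and avoiding it suffices: an `F` in the closure then
  -- lies in the set.
  have h2 : Dense (⋂ P : (Σ a, Scheme a 1) × ℕ, (frontier (solvesAt P.1.2 P.2))ᶜ) := by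
    refine dense_iInter_of_isOpen (fun P => isClosed_frontier.isOpen_compl) fun P => ?_
    rw [← interior_eq_empty_iff_dense_compl, ← frontier_compl]
    exact interior_frontier (isOpen_solvesAt _ _).isClosed_compl
  have h3 : Dense ((⋂ P : Σ a, Scheme a 1, {F | P.2.app F ≠ g}) ∩
      ⋂ P : (Σ a, Scheme a 1) × ℕ, (frontier (solvesAt P.1.2 P.2))ᶜ) := by
    refine h1.inter_of_Gδ (.iInter_of_isOpen fun P => isOpen_app_ne P.2 g)
      (.iInter_of_isOpen fun P => isClosed_frontier.isOpen_compl) h2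
  obtain ⟨F, hF1, hF2⟩ := h3.nonempty
  rw [Set.mem_iInter] at hF1 hF2
  refine ⟨F, ?_, fun ⟨a, P, h⟩ => hF1 ⟨a, P⟩ h.symm⟩
  rw [standard_models_BCT_iff]
  rintro w ⟨a, P, rfl⟩ hw
  -- The solution is the first function of the sequence to which the instance has no access.
  refine ⟨F a, mem_prSpan F a, fun n => ?_⟩
  have hmem : F ∈ solvesAt P n := by
    by_contra hn
    exact hF2 (⟨a, P⟩, n) ⟨mem_closure_solvesAt P n hw, fun h => hn (interior_subset h)⟩
  exact hmem

/-- For a program computing `g`, `g x = 1` holds iff some time bound yields output `1`, and iff none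
yields `0`. These are `Σ⁰₁` and `Π⁰₁` definitions, so comprehension would put `g` into `X`. -/
theorem not_standard_models_delta01CA {X : Set (ℕ → ℕ)} {g : ℕ → ℕ} (hg : Computable g)
    (hg1 : ∀ x, g x = 0 ∨ g x = 1) (hgX : g ∉ X) : ¬ (standard X).Models Delta01CA := by
  intro H
  obtain ⟨c, hc⟩ := Nat.Partrec.Code.exists_code.1 (Partrec.nat_iff.1 hg.partrec)
  -- The default `2` marks an unfinished computation; it must differ from both possible values of
  -- `g`.
  obtain ⟨T, hT⟩ := exists_scheme_of_primrec (f := fun p =>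
      (c.evaln p.unpair.2 p.unpair.1).getD 2) <| by
    refine Primrec.option_getD.comp (Nat.Partrec.Code.primrec_evaln.comp
      ((Primrec.pair ?_ (Primrec.const c)).pair ?_)) (Primrec.const 2)
    · exact Primrec.snd.comp Primrec.unpair
    · exact Primrec.fst.comp Primrec.unpair
  have hsound : ∀ x s y, c.evaln s x = some y → y = g x := fun x s y h => by
    have := Nat.Partrec.Code.evaln_sound (Option.mem_def.2 h)
    simpa [hc] using this
  have hex : ∀ x, ∃ s, c.evaln s x = some (g x) := fun x =>
    Nat.Partrec.Code.evaln_complete.1 (by simp [hc])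
  let t : Term 0 2 := .fn T Fin.elim0 fun _ => pairT (.var 1) (.var 0)
  have ht : ∀ (F : Fin 0 → (standard X).X) (v : Fin 0 → ℕ) (x s : ℕ),
      t.value (standard X) F (Fin.cons s (Fin.cons x v : Fin 1 → ℕ)) = (c.evaln s x).getD 2 := by
    intro F v x s
    simp only [t, Term.value]
    rw [hT, Term.value_pairT]
    simp [Term.value]
  let φ : Formula 0 1 := .ex (.eq t (.succ .zero))
  let ψ : Formula 0 1 := .all (.neg (.eq t .zero))
  have hφ : ∀ (F : Fin 0 → (standard X).X) (v : Fin 0 → ℕ) (x : ℕ),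
      φ.Holds (standard X) F (Fin.cons x v) ↔ g x = 1 := by
    intro F v x
    have : φ.Holds (standard X) F (Fin.cons x v) ↔ ∃ s : ℕ, (c.evaln s x).getD 2 = 1 := by
      simp only [← ht F v]
      rfl
    rw [this]
    refine ⟨fun ⟨s, hs⟩ => ?_, fun h => (hex x).imp fun s hs => by rw [hs, h]; rfl⟩
    cases h : c.evaln s x with
    | none => simp [h] at hs
    | some y => rw [← hsound _ _ _ h]; simpa [h] using hs
  have hψ : ∀ (F : Fin 0 → (standard X).X) (v : Fin 0 → ℕ) (x : ℕ),
      ψ.Holds (standard X) F (Fin.cons x v) ↔ g x = 1 := by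
    intro F v x
    have : ψ.Holds (standard X) F (Fin.cons x v) ↔ ∀ s : ℕ, (c.evaln s x).getD 2 ≠ 0 := by
      simp only [← ht F v]
      rfl
    rw [this]
    refine ⟨fun h => ?_, fun h s => ?_⟩
    · obtain ⟨s, hs⟩ := hex x
      refine (hg1 x).resolve_left fun h0 => h s ?_
      rw [hs, h0]
      rfl
    · cases hs : c.evaln s x with
      | none => simp
      | some y => simp [hsound _ _ _ hs, h]
  have hax : (compAxiom φ ψ).Holds (standard X) Fin.elim0 Fin.elim0 :=
    H ⟨0, 0, compAxiom φ ψ⟩ ⟨0, 0, φ, ψ, .ex (.of (.eq _ _)), .all (.of (.neg (.eq _ _))), rfl⟩ _ _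
  obtain ⟨f, hf, hfg⟩ := (holds_compAxiom_standard X φ ψ _ _).1 hax fun x => by rw [hφ, hψ]
  refine hgX ((?_ : f = g) ▸ hf)
  funext x
  have := hfg x
  rw [hφ] at this
  rcases hg1 x with h | h
  · rw [h, this.2 (by simp [h])]
  · rw [h, this.1 h]

/-! ### A computable characteristic function that is not primitive recursive -/

/-- Replacement of all unbounded searches in a program by the constant `0`. -/
def stripSearch : Nat.Partrec.Code → Nat.Partrec.Code
  | .zero => .zero
  | .succ => .succ
  | .left => .left
  | .right => .right
  | .pair c d => .pair (stripSearch c) (stripSearch d)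
  | .comp c d => .comp (stripSearch c) (stripSearch d)
  | .prec c d => .prec (stripSearch c) (stripSearch d)
  | .rfind' _ => .zero

theorem primrec_stripSearch : Primrec stripSearch := by
  have h3 : Primrec fun a : Nat.Partrec.Code × Nat.Partrec.Code × Nat.Partrec.Code ×
      Nat.Partrec.Code × Nat.Partrec.Code => a.2.2.2.1 :=
    Primrec.fst.comp (Primrec.snd.comp (Primrec.snd.comp Primrec.snd))
  have h4 : Primrec fun a : Nat.Partrec.Code × Nat.Partrec.Code × Nat.Partrec.Code ×
      Nat.Partrec.Code × Nat.Partrec.Code => a.2.2.2.2 :=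
    Primrec.snd.comp (Primrec.snd.comp (Primrec.snd.comp Primrec.snd))
  have h := Nat.Partrec.Code.primrec_recOn (α := Nat.Partrec.Code) (σ := Nat.Partrec.Code)
    (c := id) Primrec.id (z := fun _ => .zero) (Primrec.const _) (s := fun _ => .succ)
    (Primrec.const _) (l := fun _ => .left) (Primrec.const _) (r := fun _ => .right)
    (Primrec.const _) (pr := fun _ _ _ c d => .pair c d)
    (Nat.Partrec.Code.primrec₂_pair.comp h3 h4) (co := fun _ _ _ c d => .comp c d)
    (Nat.Partrec.Code.primrec₂_comp.comp h3 h4) (pc := fun _ _ _ c d => .prec c d)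
    (Nat.Partrec.Code.primrec₂_prec.comp h3 h4) (rf := fun _ _ _ => .zero) (Primrec.const _)
  refine h.of_eq fun c => ?_
  simp only [id]
  induction c <;> simp_all [stripSearch]

/-- The total function computed by a program in which all unbounded searches are replaced by the
constant `0`. -/
def totalEval : Nat.Partrec.Code → ℕ → ℕ
  | .zero, _ => 0
  | .succ, n => n + 1
  | .left, n => n.unpair.1
  | .right, n => n.unpair.2
  | .pair c d, n => Nat.pair (totalEval c n) (totalEval d n)
  | .comp c d, n => totalEval c (totalEval d n)
  | .prec c d, n => Nat.rec (totalEval c n.unpair.1)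
      (fun y r => totalEval d (Nat.pair n.unpair.1 (Nat.pair y r))) n.unpair.2
  | .rfind' _, _ => 0

/-- Without searches every program halts. This makes `totalEval` computable uniformly in the
program, through the universal evaluator. -/
theorem eval_stripSearch (c : Nat.Partrec.Code) (n : ℕ) :
    (stripSearch c).eval n = Part.some (totalEval c n) := by
  induction c generalizing n with
  | zero => rfl
  | succ => rfl
  | left => rfl
  | right => rfl
  | pair c d ihc ihd => simp [stripSearch, Nat.Partrec.Code.eval, ihc, ihd, totalEval, Seq.seq]
  | comp c d ihc ihd =>
    simp only [stripSearch, Nat.Partrec.Code.eval, ihd, totalEval]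
    exact (Part.bind_some _ _).trans (ihc _)
  | prec c d ihc ihd =>
    obtain ⟨x, y, rfl⟩ : ∃ x y, n = Nat.pair x y := ⟨_, _, (Nat.pair_unpair n).symm⟩
    simp only [stripSearch, totalEval, Nat.unpair_pair]
    induction y with
    | zero => exact (Nat.Partrec.Code.eval_prec_zero _ _ _).trans (ihc x)
    | succ y ih =>
      rw [Nat.Partrec.Code.eval_prec_succ, ih]
      simp [ihd]
  | rfind' c _ => rfl

theorem exists_totalEval_eq {f : ℕ → ℕ} (hf : Nat.Primrec f) : ∃ c, totalEval c = f := by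
  induction hf with
  | zero => exact ⟨.zero, rfl⟩
  | succ => exact ⟨.succ, rfl⟩
  | left => exact ⟨.left, rfl⟩
  | right => exact ⟨.right, rfl⟩
  | pair _ _ ihf ihg =>
    obtain ⟨⟨c, rfl⟩, d, rfl⟩ := And.intro ihf ihg
    exact ⟨.pair c d, rfl⟩
  | comp _ _ ihf ihg =>
    obtain ⟨⟨c, rfl⟩, d, rfl⟩ := And.intro ihf ihg
    exact ⟨.comp c d, rfl⟩
  | prec _ _ ihf ihg =>
    obtain ⟨⟨c, rfl⟩, d, rfl⟩ := And.intro ihf ihg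
    exact ⟨.prec c d, rfl⟩

/-- Search-free programs compute every primitive recursive function and have a computable evaluator.
The function `1 - totalEval` on the diagonal differs from the function of each program `c` at the
code of `c`. -/
theorem exists_computable_not_primrec : ∃ g : ℕ → ℕ, Computable g ∧
    (∀ x, g x = 0 ∨ g x = 1) ∧ ¬ Primrec g := by
  have hd : Computable fun n => totalEval (Denumerable.ofNat Nat.Partrec.Code n) n := by
    refine (Nat.Partrec.Code.eval_part.comp (primrec_stripSearch.to_comp.comp
      (Computable.ofNat Nat.Partrec.Code)) Computable.id).of_eq fun n => ?_
    exact eval_stripSearch _ _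
  refine ⟨fun n => 1 - totalEval (Denumerable.ofNat Nat.Partrec.Code n) n,
    Primrec.nat_sub.to_comp.comp (Computable.const 1) hd, fun x => by grind, fun h => ?_⟩
  obtain ⟨c, hc⟩ := exists_totalEval_eq (Primrec.nat_iff.1 h)
  have := congrFun hc (Encodable.encode c)
  rw [Denumerable.ofNat_encode] at this
  omega

end RevMath

theorem mainTheorem3 :
    -- over `PRA²`, the principle `BCT` does not imply `Δ⁰₁-CA`, nor `2^ℕ-RCA₀`
    (¬ RevMath.Implies (RevMath.PRA2 ∪ RevMath.BCT) RevMath.Delta01CA ∧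
      ¬ RevMath.Implies (RevMath.PRA2 ∪ RevMath.BCT) RevMath.TwoNRCA0) ∧
    -- over `PRA²`, neither `Δ⁰₁-CA` nor `2^ℕ-RCA₀` implies `BCT`
    (¬ RevMath.Implies (RevMath.PRA2 ∪ RevMath.Delta01CA) RevMath.BCT ∧
      ¬ RevMath.Implies (RevMath.PRA2 ∪ RevMath.TwoNRCA0) RevMath.BCT) ∧
    -- a primitive recursive instance of `BCT` without primitive recursively bounded solutions
    (∃ V : ℕ → ℕ → List ℕ, Primrec₂ V ∧ RevMath.IsInstance V ∧
      ∀ h : ℕ → ℕ, RevMath.IsSolution V h → ¬ RevMath.PRBounded h) ∧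
    -- a standard model of `2^ℕ-RCA₀`, of primitive recursively bounded computable functions only,
    -- in which `BCT` fails
    (∃ X : Set (ℕ → ℕ), RevMath.PRClosed X ∧
      (∀ h ∈ X, Computable h ∧ RevMath.PRBounded h) ∧
      (RevMath.standard X).Models
        (RevMath.PRA2 ∪ RevMath.FullInduction ∪ RevMath.TwoNRCA0) ∧
      ¬ (RevMath.standard X).Models RevMath.BCT) ∧
    -- a standard model of `BCT` in which `Δ⁰₁-CA` fails
    (∃ X : Set (ℕ → ℕ), RevMath.PRClosed X ∧
      (RevMath.standard X).Models (RevMath.PRA2 ∪ RevMath.FullInduction ∪ RevMath.BCT) ∧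
      ¬ (RevMath.standard X).Models RevMath.Delta01CA) ∧
    -- which can be chosen to omit any given computable `0`-`1` function that is not primitive
    -- recursive
    (∀ g : ℕ → ℕ, Computable g → (∀ x, g x = 0 ∨ g x = 1) → ¬ Primrec g →
      ∃ X : Set (ℕ → ℕ), RevMath.PRClosed X ∧ g ∉ X ∧
        (RevMath.standard X).Models (RevMath.PRA2 ∪ RevMath.FullInduction ∪ RevMath.BCT) ∧
        ¬ (RevMath.standard X).Models RevMath.Delta01CA) := by
  open RevMath in
  have hB : ∃ X : Set (ℕ → ℕ), PRClosed X ∧ (∀ h ∈ X, Computable h ∧ PRBounded h) ∧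
      (standard X).Models (PRA2 ∪ FullInduction ∪ TwoNRCA0) ∧ ¬ (standard X).Models BCT := by
    refine ⟨_, prClosed_computable_prBounded, fun h hh => hh, ?_, not_standard_models_BCT⟩
    rintro φ ((h | h) | (h | h))
    · exact prClosed_computable_prBounded.models_PRA2 φ h
    · exact standard_models_fullInduction _ φ h
    · exact standard_models_iSigma01 _ φ h
    · exact standard_models_delta01CA φ h
  open RevMath in
  have hG : ∀ g : ℕ → ℕ, Computable g → (∀ x, g x = 0 ∨ g x = 1) → ¬ Primrec g →
      ∃ X : Set (ℕ → ℕ), PRClosed X ∧ g ∉ X ∧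
        (standard X).Models (PRA2 ∪ FullInduction ∪ BCT) ∧
        ¬ (standard X).Models Delta01CA := by
    intro g hg hg1 hgp
    obtain ⟨F, hF, hgF⟩ := exists_generic hgp
    refine ⟨prSpan F, prClosed_prSpan F, hgF, ?_, not_standard_models_delta01CA hg hg1 hgF⟩
    rintro φ ((h | h) | h)
    · exact (prClosed_prSpan F).models_PRA2 φ h
    · exact standard_models_fullInduction _ φ h
    · exact hF φ h
  obtain ⟨X, hX, hXb, hXm, hXn⟩ := hB
  obtain ⟨g, hg, hg1, hgp⟩ := RevMath.exists_computable_not_primrec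
  obtain ⟨Y, hY, -, hYm, hYn⟩ := hG g hg hg1 hgp
  have hY' : (RevMath.standard Y).Models (RevMath.PRA2 ∪ RevMath.BCT) := fun φ h =>
    hYm φ (h.imp_left Or.inl)
  exact ⟨⟨fun H => hYn (H _ hY'), fun H => hYn fun φ h => H _ hY' φ (Or.inr h)⟩,
    ⟨fun H => hXn (H _ fun φ h => hXm φ (h.imp Or.inl Or.inr)),
      fun H => hXn (H _ fun φ h => hXm φ (h.imp_left Or.inl))⟩,
    RevMath.exists_primrec_instance, ⟨X, hX, hXb, hXm, hXn⟩, ⟨Y, hY, hYm, hYn⟩, hG⟩
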